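/- Let $d\ge 1$ and $L>0$. For $\varepsilon\in\mathbf{R}$, a finite set $\Lambda\subset\mathbf{Z}^d$ and $x\in\mathbf{R}^{\mathbf{Z}^d}$ put $$H_\Lambda(x)=\frac12\sum_{i\in\Lambda}x_i^2-\frac{\varepsilon}{2d}\sum_{\substack{\{i,j\}:\ \|i-j\|_1=1,\\ \{i,j\}\cap\Lambda\ne\emptyset}}x_ix_j ,$$ each unordered pair $\{i,j\}$ being counted once. For $\xi\in[-L,L]^{\mathbf{Z}^d}$ let $\pi^{\varepsilon,L}_\Lambda(\cdot\mid\xi)$ be the probability measure on $[-L,L]^\Lambda$ whose density with respect to Lebesgue measure is $\frac{1}{Z^{\xi}_\Lambda}\exp(-H_\Lambda(x_\Lambda\xi_{\Lambda^c}))$, where $x_\Lambda\xi_{\Lambda^c}$ agrees with $x_\Lambda$ on $\Lambda$ and with $\xi$ outside $\Lambda$, and $Z^\xi_\Lambda$ is the normalising constant. A Gibbs measure of the truncated Gaussian model is a probability measure $\mu$ on $[-L,L]^{\mathbf{Z}^d}$ such that, for every finite $\Lambda$, the conditional law under $\mu$ of $X|_\Lambda$ given $(X_i)_{i\notin\Lambda}=(\xi_i)_{i\notin\Lambda}$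 is $\pi^{\varepsilon,L}_\Lambda(\cdot\mid\xi)$ for $\mu$-a.e. $\xi$. There is $\varepsilon_0>0$ (depending on $d$ and $L$) such that for every $\varepsilon$ with $|\varepsilon|<\varepsilon_0$ there is exactly one such Gibbs measure $\mu^L_\varepsilon$, and: 1. $\mu^L_\varepsilon$ is a finitary factor of an i.i.d. process, with exponential tails. That is, there are a probability space $(\mathcal{Y},\mathcal{F},\nu)$ and a measurable map $F:\mathcal{Y}^{\mathbf{Z}^d}\to[-L,L]^{\mathbf{Z}^d}$, commuting with all translations of $\mathbf{Z}^d$, such that $\mu^L_\varepsilon$ is the image of $\nu^{\otimes\mathbf{Z}^d}$ under $F$, and such that the coding radius $$R(y)=\inf\{r\ge 0:\ \forall y'\in\mathcal{Y}^{\mathbf{Z}^d},\ (y'_j=y_j \text{ whenever } \|j\|_1\le r)\implies F(y')_0=F(y)_0\}$$ is $\nu^{\otimes\mathbf{Z}^d}$-almost surely finite and satisfies, for some constants $C,c>0$, $\mathbf{P}(R\ge n)\le Ce^{-cn}$ for all $n\in\mathbf{N}$, where $\mathbf{P}=\nu^{\otimes\mathbf{Z}^d}$. 2. There is $c>0$ such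 that for every $l\in\mathbf{N}$ there is an $l$-dependent probability measure $\nu_l$ on $[-L,L]^{\mathbf{Z}^d}$ (i.e. for all $A,B\subset\mathbf{Z}^d$ at $\ell^1$ distance greater than $l$, the restrictions to $A$ and to $B$ of a field of law $\nu_l$ are independent) such that for every finite $\Lambda\subset\mathbf{Z}^d$ $$d_{\mathrm{TV}}(\mu^L_\varepsilon|_\Lambda,\nu_l|_\Lambda)\le|\Lambda|\,e^{-cl},$$ where $\mu|_\Lambda$ denotes the marginal of $\mu$ on $[-L,L]^\Lambda$ and $d_{\mathrm{TV}}(\mu,\nu)=\sup_A|\mu(A)-\nu(A)|$, the supremum being over measurable sets. -/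

import Mathlib

open MeasureTheory ProbabilityTheory

noncomputable section

/-- The lattice `ℤ^d`. -/
abbrev Site (d : ℕ) : Type := Fin d → ℤ

/-- The `ℓ¹` distance on `ℤ^d`. -/
def latticeDist {d : ℕ} (i j : Site d) : ℕ := ∑ k, (i k - j k).natAbs

/-- The configuration `(x_{k+i})_i`, i.e. `x` translated by `k`. -/
def shiftConfig {d : ℕ} {S : Type*} (k : Site d) (x : Site d → S) : Site d → S :=
  fun i => x (k + i)

/-! ### Factors of i.i.d. processes -/

/-- `F` is a coding from the product measure `ν^{⊗ ℤ^d}` to `μ`: it is measurable, commutes with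
all the translations, and sends `ν^{⊗ ℤ^d}` to `μ`. -/
structure IsCoding {d : ℕ} {S Y : Type*} [MeasurableSpace S] [MeasurableSpace Y]
    (ν : Measure Y) [IsProbabilityMeasure ν] (μ : Measure (Site d → S))
    (F : (Site d → Y) → (Site d → S)) : Prop where
  measurable : Measurable F
  commutes : ∀ (k : Site d) (y : Site d → Y), F (shiftConfig k y) = shiftConfig k (F y)
  map_eq : (Measure.infinitePi fun _ : Site d => ν).map F = μ

/-- The coding radius of `F` at the site `i` and the configuration `y`: the least `r` such that
`F(y)_i` is determined by `y` on the `ℓ¹` ball of radius `r` around `i`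
(`⊤` if there is no such `r`). -/
def codingRadius {d : ℕ} {S Y : Type*} (F : (Site d → Y) → (Site d → S))
    (i : Site d) (y : Site d → Y) : ℕ∞ :=
  ⨅ (r : ℕ) (_ : ∀ y' : Site d → Y, (∀ j, latticeDist j i ≤ r → y' j = y j) → F y i = F y' i),
    (r : ℕ∞)

/-- `μ` is a finitary factor of an i.i.d. process, with exponential tails for the coding radius. -/
def IsFFIIDWithExpTails {d : ℕ} {S : Type*} [MeasurableSpace S]
    (μ : Measure (Site d → S)) : Prop :=
  ∃ (Y : Type) (_ : MeasurableSpace Y) (ν : Measure Y) (_ : IsProbabilityMeasure ν)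
    (F : (Site d → Y) → (Site d → S)),
    IsCoding ν μ F ∧
    (∀ᵐ y ∂(Measure.infinitePi fun _ : Site d => ν), codingRadius F 0 y ≠ ⊤) ∧
    ∃ C : ℝ, 0 < C ∧ ∃ c : ℝ, 0 < c ∧ ∀ n : ℕ,
      (Measure.infinitePi fun _ : Site d => ν) {y | (n : ℕ∞) ≤ codingRadius F 0 y} ≤
        ENNReal.ofReal (C * Real.exp (-c * n))

/-! ### Finite dependence and total variation -/

/-- `μ` is `l`-dependent: the restrictions of the field to two sets of sites at `ℓ¹` distance
greater than `l` are independent. -/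
def IsDependentOfRange {d : ℕ} {S : Type*} [MeasurableSpace S] (l : ℕ)
    (μ : Measure (Site d → S)) : Prop :=
  ∀ A B : Set (Site d), (∀ a ∈ A, ∀ b ∈ B, l < latticeDist a b) →
    IndepFun (fun x : Site d → S => A.domRestrict x) (fun x : Site d → S => B.domRestrict x) μ

/-- The total variation distance `sup_A |μ(A) - ν(A)|` of two probability measures. -/
def tvDistance {X : Type*} [MeasurableSpace X] (μ ν : Measure X) : ℝ :=
  ⨆ A : {A : Set X // MeasurableSet A}, |μ.real A - ν.real A|

/-- The marginal of `μ` on the finite set `Λ` of sites. -/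
def marginal {d : ℕ} {S : Type*} [MeasurableSpace S] (μ : Measure (Site d → S))
    (Λ : Finset (Site d)) : Measure (Λ → S) :=
  μ.map fun x => Λ.restrict x

/-! ### The truncated Gaussian model -/

/-- The Hamiltonian
`H_Λ(x) = 1/2 ∑_{i ∈ Λ} x_i² - ε/(2d) ∑_{i ∼ j, {i,j} ∩ Λ ≠ ∅} x_i x_j`,
where each unordered pair of nearest neighbours is counted once. Such a pair is `{i, i + e_k}` for
exactly one site `i` and one `k`, with `e_k = Pi.single k 1`, and it meets `Λ` if and only if
`i ∈ Λ` or `i ∈ Λ - e_k`. -/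
def hamiltonian {d : ℕ} (ε : ℝ) (Λ : Finset (Site d)) (x : Site d → ℝ) : ℝ :=
  1 / 2 * ∑ i ∈ Λ, x i ^ 2 -
    ε / (2 * d) * ∑ k : Fin d, ∑ i ∈ Λ ∪ Λ.image (fun j => j - Pi.single k 1),
      x i * x (i + Pi.single k 1)

/-- The configuration that agrees with `x` on `Λ` and with `ξ` outside `Λ`. -/
def glue {d : ℕ} {S : Type*} (Λ : Finset (Site d)) (x : Λ → S) (ξ : Site d → S) :
    Site d → S :=
  fun i => if h : i ∈ Λ then x ⟨i, h⟩ else ξ i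

/-- The specification of the Gaussian model truncated to `[-L, L]`: the probability measure on
`[-L, L]^Λ` with density `exp (-H_Λ(x_Λ ξ_{Λᶜ})) / Z` with respect to Lebesgue measure, where `Z`
is the normalising constant. -/
def truncatedSpec {d : ℕ} (ε L : ℝ) (Λ : Finset (Site d))
    (ξ : Site d → Set.Icc (-L) L) : Measure (Λ → Set.Icc (-L) L) :=
  (Measure.pi fun _ : Λ => (volume : Measure ℝ).comap (Subtype.val : Set.Icc (-L) L → ℝ)).tilted
    fun x => -hamiltonian ε Λ fun i => (glue Λ x ξ i).1

/-- `μ` is a Gibbs measure of the truncated Gaussian model (DLR equations): for every finite `Λ`,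
the conditional law of the field on `Λ` given the field outside `Λ` is the specification. -/
structure IsTruncatedGibbs {d : ℕ} (ε L : ℝ) (μ : Measure (Site d → Set.Icc (-L) L)) :
    Prop where
  isProbabilityMeasure : IsProbabilityMeasure μ
  dlr : ∀ (Λ : Finset (Site d)) (A : Set (Λ → Set.Icc (-L) L)), MeasurableSet A →
    μ⟦{x | Λ.restrict x ∈ A} | cylinderEvents (X := fun _ : Site d => Set.Icc (-L) L)
      ((Λ : Set (Site d))ᶜ)⟧ =ᵐ[μ] fun ξ => (truncatedSpec ε L Λ ξ).real A

end

/-!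
The proof is by coupling from the past for a dynamics with rejection sampling. Each site is given,
at each time, a fair coin, a proposal drawn from the single-site law without interaction, and a
uniform variable. A site is active if its coin shows heads and those of its neighbours show tails;
an active site adopts its proposal if the uniform variable is at most `exp (z h_i - |ε| L²)`,
where `z` is the proposal and `h_i` the field of the neighbours, and keeps its spin otherwise. This
update preserves every measure that satisfies the DLR equation at the site, and updates of sites
that are not adjacent commute.

If the uniform variable is at most `exp (-2 |ε| L²)`, then the proposal is accepted whatever the
neighbours are. The sites that can influence a given spin are therefore explored backwards in time
by a process that is dominated by a branching process, which is subcritical for small `ε`. Hence a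
spin at time `0` is a function of the randomness in a ball whose radius has exponential tails. Any
measure invariant under the updates in a large box is close, on a small set, to the law of this
function: applied to a Gibbs measure this gives uniqueness, and applied to the finite-volume Gibbs
measures in growing boxes it gives existence.

The finitely dependent approximations are obtained by replacing all the randomness outside a ball
by a constant before the coding is applied.
-/

noncomputable section

open scoped ENNReal

/-! ### Cylinder events and product measures -/

section Cylinders

variable {ι : Type*} {X : ι → Type*} [∀ i, MeasurableSpace (X i)]

theorem measurable_cylinderEvents_of_dependsOn {Z : Type*} [MeasurableSpace Z] {Δ : Set ι}
    [Nonempty (∀ i, X i)] {f : (∀ i, X i) → Z} (hf : Measurable f) (hΔ : DependsOn f Δ) :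
    Measurable[cylinderEvents Δ] f := by
  classical
  let o : ∀ i, X i := Classical.arbitrary _
  let φ : (∀ i, X i) → ∀ i, X i := fun x i => if i ∈ Δ then x i else o i
  have hφ : Measurable[cylinderEvents Δ] φ := by
    refine @measurable_pi_lambda _ _ _ (cylinderEvents Δ) _ _ fun i => ?_
    by_cases hi : i ∈ Δ
    · simpa only [φ, if_pos hi] using measurable_cylinderEvent_apply hi
    · simpa only [φ, if_neg hi] using @measurable_const _ _ _ (cylinderEvents Δ) _
  have hfφ : f = f ∘ φ := funext fun x => hΔ fun i hi => (if_pos hi).symm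
  rw [hfφ]
  exact hf.comp hφ

theorem cylinderEvents_eq_comap_domRestrict (Δ : Set ι) :
    cylinderEvents (X := X) Δ = MeasurableSpace.comap Δ.domRestrict MeasurableSpace.pi := by
  refine le_antisymm (iSup₂_le fun i hi => ?_) ?_
  · rw [← measurable_iff_comap_le]
    exact (measurable_pi_apply (X := fun j : Δ => X j) ⟨i, hi⟩).comp (comap_measurable _)
  · rw [← measurable_iff_comap_le]
    exact measurable_restrict_cylinderEvents Δ

theorem dependsOn_mem_of_measurableSet_cylinderEvents {Δ : Set ι} {B : Set (∀ i, X i)}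
    (hB : MeasurableSet[cylinderEvents Δ] B) : DependsOn (· ∈ B) Δ := by
  rw [cylinderEvents_eq_comap_domRestrict] at hB
  obtain ⟨B', -, rfl⟩ := hB
  intro x y hxy
  simp only [Set.mem_preimage, Set.dependsOn_domRestrict Δ hxy]

theorem measurableSet_cylinderEvents_pi {Δ : Set ι} {s : Set ι} (hs : s.Countable) (hΔ : s ⊆ Δ)
    {t : ∀ i, Set (X i)} (ht : ∀ i, MeasurableSet (t i)) :
    MeasurableSet[cylinderEvents Δ] (s.pi t) := by
  rw [Set.pi_def]
  exact MeasurableSet.biInter hs fun i hi => measurable_cylinderEvent_apply (hΔ hi) (ht i)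

theorem measure_ext_of_inter_cylinderEvents {μ ν : Measure (∀ i, X i)} [IsFiniteMeasure μ]
    (Δ : Set ι)
    (h : ∀ A B, MeasurableSet[cylinderEvents Δ] A → MeasurableSet[cylinderEvents Δᶜ] B →
      μ (A ∩ B) = ν (A ∩ B)) : μ = ν := by
  refine ext_of_generate_finite _ generateFrom_squareCylinders.symm
    (isPiSystem_squareCylinders (fun _ => MeasurableSpace.isPiSystem_measurableSet)
      (fun _ => MeasurableSet.univ)) ?_ ?_
  · rintro _ ⟨s, t, ht, rfl⟩
    rw [← Set.inter_union_sdiff (s : Set ι) Δ, Set.union_pi]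
    exact h _ _
      (measurableSet_cylinderEvents_pi (s.countable_toSet.mono Set.inter_subset_left)
        Set.inter_subset_right fun i => ht i (Set.mem_univ i))
      (measurableSet_cylinderEvents_pi (s.countable_toSet.mono Set.sdiff_subset)
        (fun _ hi => hi.2) fun i => ht i (Set.mem_univ i))
  · simpa using h Set.univ Set.univ MeasurableSet.univ MeasurableSet.univ

theorem measure_ext_of_dependsOn {μ ν : Measure (∀ i, X i)} [IsFiniteMeasure μ]
    (h : ∀ (Δ : Finset ι) (f : (∀ i, X i) → ℝ≥0∞), Measurable f → (∀ x, f x ≤ 1) →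
      DependsOn f (Δ : Set ι) → ∫⁻ x, f x ∂μ = ∫⁻ x, f x ∂ν) : μ = ν := by
  refine ext_of_generate_finite _ generateFrom_measurableCylinders.symm
    isPiSystem_measurableCylinders (fun s hs => ?_) ?_
  · obtain ⟨Δ, A, hA, rfl⟩ := (mem_measurableCylinders _).1 hs
    rw [← lintegral_indicator_one (hA.cylinder Δ), ← lintegral_indicator_one (hA.cylinder Δ)]
    exact h Δ _ (measurable_one.indicator (hA.cylinder Δ))
      (fun x => Set.indicator_le_self' (fun _ _ => zero_le) x)
      (dependsOn_cylinder_indicator_const A 1)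
  · rw [← lintegral_one, ← lintegral_one]
    exact h ∅ _ measurable_const (fun _ => le_rfl) fun _ _ _ => rfl

theorem dependsOn_lmarginal [DecidableEq ι] {ρ : ∀ i, Measure (X i)} {Λ : Finset ι}
    {f : (∀ i, X i) → ℝ≥0∞} {Δ : Set ι} (hf : DependsOn f Δ) :
    DependsOn (∫⋯∫⁻_Λ, f ∂ρ) Δ := by
  intro ξ η h
  refine lintegral_congr fun x => hf fun i hi => ?_
  simp only [Function.updateFinset, h i hi]

theorem lmarginal_mul_of_dependsOn [DecidableEq ι] (ρ : ∀ i, Measure (X i)) (Λ : Finset ι)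
    {f g : (∀ i, X i) → ℝ≥0∞} (hf : Measurable f) (hg : DependsOn g (Λ : Set ι)ᶜ) :
    ∫⋯∫⁻_Λ, g * f ∂ρ = g * ∫⋯∫⁻_Λ, f ∂ρ := by
  ext x
  have hgx (y : ∀ i : Λ, X i) : g (Function.updateFinset x Λ y) = g x :=
    hg fun i hi => by
      rw [Set.mem_compl_iff, Finset.mem_coe] at hi
      simp only [Function.updateFinset, hi, dite_false]
  simp only [lmarginal, Pi.mul_apply, hgx]
  exact lintegral_const_mul _ (hf.comp measurable_updateFinset)

end Cylinders

theorem lintegral_le_add_measure {α : Type*} [MeasurableSpace α] {μ : Measure α} {E : Set α}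
    (hE : MeasurableSet E) {f g : α → ℝ≥0∞} (hf : ∀ a, f a ≤ 1) (hfg : ∀ a ∉ E, f a ≤ g a) :
    ∫⁻ a, f a ∂μ ≤ ∫⁻ a, g a ∂μ + μ E := by
  rw [← lintegral_indicator_one hE, ← lintegral_add_right _ (measurable_one.indicator hE)]
  refine lintegral_mono fun a => ?_
  by_cases ha : a ∈ E
  · exact le_add_left ((hf a).trans_eq (Set.indicator_of_mem ha 1).symm)
  · exact (hfg a ha).trans le_self_add

section InfiniteProduct

variable {ι : Type*} {X : ι → Type*} [∀ i, MeasurableSpace (X i)] (μ : ∀ i, Measure (X i))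
  [∀ i, IsProbabilityMeasure (μ i)]

theorem infinitePi_prod_map_update [DecidableEq ι] (i : ι) :
    ((Measure.infinitePi μ).prod (μ i)).map (fun p => Function.update p.1 i p.2) =
      Measure.infinitePi μ := by
  refine Measure.eq_infinitePi _ fun s t ht => ?_
  rw [Measure.map_apply measurable_update' (.pi s.countable_toSet fun _ _ => ht _)]
  have hbox : (fun p : (∀ j, X j) × X i => Function.update p.1 i p.2) ⁻¹' (s : Set ι).pi t =
      ((s.erase i : Finset ι) : Set ι).pi t ×ˢ (if i ∈ s then t i else Set.univ) := by
    ext ⟨x, z⟩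
    simp only [Set.mem_preimage, Set.mem_pi, Finset.mem_coe, Set.mem_prod, Finset.mem_erase]
    grind [Function.update_apply]
  rw [hbox, Measure.prod_prod, Measure.infinitePi_pi _ fun i _ => ht i]
  split_ifs with hi
  · rw [mul_comm, Finset.mul_prod_erase s (fun i => μ i (t i)) hi]
  · rw [measure_univ, mul_one, Finset.erase_eq_of_notMem hi]

theorem lintegral_infinitePi_eq_lintegral_update [DecidableEq ι] (i : ι)
    {f : (∀ i, X i) → ℝ≥0∞} (hf : Measurable f) :
    ∫⁻ x, f x ∂Measure.infinitePi μ =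
      ∫⁻ x, ∫⁻ z, f (Function.update x i z) ∂μ i ∂Measure.infinitePi μ := by
  conv_lhs => rw [← infinitePi_prod_map_update μ i, lintegral_map hf measurable_update']
  exact lintegral_prod _ (hf.comp measurable_update').aemeasurable

theorem measurePreserving_sumElim_infinitePi {α β Y : Type*} [MeasurableSpace Y] (ν : Measure Y)
    [IsProbabilityMeasure ν] :
    MeasurePreserving (fun p : (α → Y) × (β → Y) => Sum.elim p.1 p.2)
      ((Measure.infinitePi fun _ : α => ν).prod (Measure.infinitePi fun _ : β => ν))
      (Measure.infinitePi fun _ : α ⊕ β => ν) := by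
  have hm : Measurable fun p : (α → Y) × (β → Y) => Sum.elim p.1 p.2 := by
    refine measurable_pi_iff.2 ?_
    rintro (a | b) <;> simp only [Sum.elim_inl, Sum.elim_inr] <;> fun_prop
  refine ⟨hm, Measure.eq_infinitePi _ fun s t ht => ?_⟩
  rw [Measure.map_apply hm (.pi s.countable_toSet fun _ _ => ht _)]
  have hbox : (fun p : (α → Y) × (β → Y) => Sum.elim p.1 p.2) ⁻¹' (s : Set (α ⊕ β)).pi t =
      (s.toLeft : Set α).pi (fun a => t (.inl a)) ×ˢ
        (s.toRight : Set β).pi fun b => t (.inr b) := by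
    ext p
    simp [Set.mem_pi]
  rw [hbox, Measure.prod_prod, Measure.infinitePi_pi _ fun a _ => ht _,
    Measure.infinitePi_pi _ fun b _ => ht _, Finset.prod_sum_eq_prod_toLeft_mul_prod_toRight]

end InfiniteProduct

/-! ### Proper kernels and conditional probabilities -/

section ProperKernel

variable {Ω : Type*} {m m₀ : MeasurableSpace Ω} {π : Kernel[m, m₀] Ω Ω}

theorem condExp_indicator_ae_eq_properKernel_iff [IsMarkovKernel π] (hm : m ≤ m₀)
    (hπ : π.IsProper) {μ : Measure[m₀] Ω} [IsProbabilityMeasure μ] {A : Set Ω}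
    (hA : MeasurableSet[m₀] A) :
    μ⟦A | m⟧ =ᵐ[μ] (fun ω => (π ω).real A) ↔
      ∀ B, MeasurableSet[m] B → (π ∘ₘ μ) (A ∩ B) = μ (A ∩ B) := by
  have : IsProbabilityMeasure (π ∘ₘ μ) :=
    isProbabilityMeasure_bind (π.measurable.mono hm le_rfl).aemeasurable
      (.of_forall fun ω => inferInstance)
  have hmeas : Measurable[m] fun ω => (π ω).real A := (π.measurable_coe hA).ennreal_toReal
  have hint : Integrable (fun ω => (π ω).real A) μ :=
    .of_bound (hmeas.mono hm le_rfl).aestronglyMeasurable 1 <| .of_forall fun ω => by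
      rw [Real.norm_of_nonneg measureReal_nonneg]
      exact measureReal_le_one
  have hind : Integrable (A.indicator fun _ => (1 : ℝ)) μ := (integrable_const 1).indicator hA
  have hset (B : Set Ω) (hB : MeasurableSet[m] B) :
      ∫ ω in B, (π ω).real A ∂μ = ((π ∘ₘ μ) (A ∩ B)).toReal := by
    rw [← hπ.setLIntegral_eq_comp hm hA hB]
    exact integral_toReal ((π.measurable_coe hA).mono hm le_rfl).aemeasurable
      (.of_forall fun ω => measure_lt_top _ _)
  have hindB (B : Set Ω) : ∫ ω in B, A.indicator (fun _ => (1 : ℝ)) ω ∂μ = μ.real (A ∩ B) := by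
    rw [setIntegral_indicator hA, Set.inter_comm]
    simp
  constructor
  · intro h B hB
    rw [← ENNReal.toReal_eq_toReal_iff' (measure_ne_top _ _) (measure_ne_top _ _), ← hset B hB,
      ← setIntegral_congr_ae (hm _ hB) (h.mono fun _ h _ => h),
      setIntegral_condExp hm hind hB, hindB, Measure.real]
  · intro h
    refine (ae_eq_condExp_of_forall_setIntegral_eq hm hind (fun B _ _ => hint.integrableOn)
      (fun B hB _ => ?_) hmeas.stronglyMeasurable.aestronglyMeasurable).symm
    rw [hset B hB, h B hB, hindB, Measure.real]

end ProperKernel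

/-! ### Space-time configurations -/

section SpaceTime

variable {ι Y : Type*}

/-- The first time slice of a space-time configuration. -/
def headSlice (y : ι → ℕ → Y) : ι → Y := fun i => y i 0

/-- The space-time configuration without its first time slice. -/
def tailSlices (y : ι → ℕ → Y) : ι → ℕ → Y := fun i n => y i (n + 1)

/-- The space-time configuration with first time slice `p.1` and later slices `p.2`. -/
def consSlice (p : (ι → Y) × (ι → ℕ → Y)) : ι → ℕ → Y :=
  fun i n => Nat.casesOn n (p.1 i) fun n => p.2 i n

/-- The index `(i, n)` of a space-time configuration, read as a site of the first slice if `n = 0`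
and as an index of the later slices otherwise. -/
def sliceEquiv (ι : Type*) : ι ⊕ ι × ℕ ≃ ι × ℕ where
  toFun := Sum.elim (fun i => (i, 0)) fun p => (p.1, p.2 + 1)
  invFun p := Nat.casesOn p.2 (.inl p.1) fun n => .inr (p.1, n)
  left_inv := by rintro (i | p) <;> rfl
  right_inv := by rintro ⟨i, _ | n⟩ <;> rfl

variable [MeasurableSpace Y]

/-- The law of i.i.d. space-time configurations. -/
abbrev spaceTimeMeasure (ι : Type*) (ν : Measure Y) : Measure (ι → ℕ → Y) :=
  Measure.infinitePi fun _ : ι => Measure.infinitePi fun _ : ℕ => ν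

theorem measurable_headSlice : Measurable (headSlice : (ι → ℕ → Y) → _) := by
  unfold headSlice
  fun_prop

theorem measurable_tailSlices : Measurable (tailSlices : (ι → ℕ → Y) → _) := by
  unfold tailSlices
  fun_prop

theorem measurePreserving_consSlice (ι : Type*) (ν : Measure Y) [IsProbabilityMeasure ν] :
    MeasurePreserving consSlice
      ((Measure.infinitePi fun _ : ι => ν).prod (spaceTimeMeasure ι ν)) (spaceTimeMeasure ι ν) := by
  have hcurry : MeasurePreserving (MeasurableEquiv.curry ι ℕ Y).symm (spaceTimeMeasure ι ν)
      (Measure.infinitePi fun _ : ι × ℕ => ν) :=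
    ⟨by fun_prop, Measure.infinitePi_map_curry_symm fun _ _ => ν⟩
  have hreindex : MeasurePreserving (MeasurableEquiv.piCongrLeft (fun _ => Y) (sliceEquiv ι))
      (Measure.infinitePi fun _ : ι ⊕ ι × ℕ => ν) (Measure.infinitePi fun _ : ι × ℕ => ν) :=
    ⟨by fun_prop, Measure.infinitePi_map_piCongrLeft (μ := fun _ => ν) (sliceEquiv ι)⟩
  have hcons := (hcurry.symm.comp hreindex).comp
    ((measurePreserving_sumElim_infinitePi ν).comp ((MeasurePreserving.id _).prod hcurry))
  convert hcons using 1
  ext p i n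
  cases n <;> rfl

theorem measurePreserving_headSlice_tailSlices (ι : Type*) (ν : Measure Y)
    [IsProbabilityMeasure ν] :
    MeasurePreserving (fun y : ι → ℕ → Y => (headSlice y, tailSlices y)) (spaceTimeMeasure ι ν)
      ((Measure.infinitePi fun _ : ι => ν).prod (spaceTimeMeasure ι ν)) := by
  have hm : Measurable fun y : ι → ℕ → Y => (headSlice y, tailSlices y) :=
    measurable_headSlice.prodMk measurable_tailSlices
  refine ⟨hm, ?_⟩
  conv_lhs => rw [← (measurePreserving_consSlice ι ν).map_eq]
  rw [Measure.map_map hm (measurePreserving_consSlice ι ν).measurable]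
  exact Measure.map_id

end SpaceTime

/-! ### Lattice distance -/

section LatticeDist

variable {d : ℕ}

theorem latticeDist_self (i : Site d) : latticeDist i i = 0 := by simp [latticeDist]

theorem latticeDist_comm (i j : Site d) : latticeDist i j = latticeDist j i :=
  Finset.sum_congr rfl fun k _ => by omega

theorem latticeDist_triangle (i j k : Site d) :
    latticeDist i k ≤ latticeDist i j + latticeDist j k := by
  unfold latticeDist
  rw [← Finset.sum_add_distrib]
  exact Finset.sum_le_sum fun k _ => by omega

theorem latticeDist_add_left (k i j : Site d) :
    latticeDist (k + i) (k + j) = latticeDist i j := by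
  simp [latticeDist]

theorem finite_setOf_latticeDist_le (i : Site d) (n : ℕ) : {j | latticeDist j i ≤ n}.Finite := by
  refine (Set.finite_Icc (i - fun _ => (n : ℤ)) (i + fun _ => (n : ℤ))).subset fun j hj => ?_
  have hcoord (k : Fin d) : (j k - i k).natAbs ≤ n :=
    (Finset.single_le_sum (f := fun k => (j k - i k).natAbs) (fun _ _ => Nat.zero_le _)
      (Finset.mem_univ k)).trans hj
  constructor <;> intro k <;> have := hcoord k <;>
    simp only [Pi.sub_apply, Pi.add_apply] <;> omega

/-- The finite set of sites at distance at most `n` from `Δ`. -/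
def thickening (Δ : Finset (Site d)) (n : ℕ) : Finset (Site d) :=
  Δ.biUnion fun i => (finite_setOf_latticeDist_le i n).toFinset

theorem mem_thickening {Δ : Finset (Site d)} {n : ℕ} {j : Site d} :
    j ∈ thickening Δ n ↔ ∃ i ∈ Δ, latticeDist j i ≤ n := by
  simp [thickening]

end LatticeDist

/-! ### Finitely dependent fields -/

section FiniteDependence

variable {d : ℕ} {S Y : Type*} [MeasurableSpace S] [MeasurableSpace Y]

theorem measurable_shiftConfig (k : Site d) : Measurable (shiftConfig (S := S) k) := by
  unfold shiftConfig
  fun_prop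

theorem infinitePi_map_shiftConfig (ν : Measure Y) [IsProbabilityMeasure ν] (k : Site d) :
    (Measure.infinitePi fun _ : Site d => ν).map (shiftConfig k) =
      Measure.infinitePi fun _ : Site d => ν := by
  refine Measure.eq_infinitePi _ fun s t ht => ?_
  have hbox : shiftConfig k ⁻¹' (s : Set (Site d)).pi t =
      ((s.image (k + ·) : Finset (Site d)) : Set (Site d)).pi fun i => t (i - k) := by
    ext y
    simp only [Set.mem_preimage, Set.mem_pi, Finset.mem_coe, Finset.forall_mem_image, shiftConfig,
      add_sub_cancel_left]
  rw [Measure.map_apply (measurable_shiftConfig k) (.pi s.countable_toSet fun _ _ => ht _), hbox,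
    Measure.infinitePi_pi _ fun i _ => ht _, Finset.prod_image fun i _ j _ h => add_left_cancel h]
  simp

theorem indep_cylinderEvents_infinitePi {ι : Type*} {X : ι → Type*} [∀ i, MeasurableSpace (X i)]
    (μ : ∀ i, Measure (X i)) [∀ i, IsProbabilityMeasure (μ i)] {A B : Set ι}
    (h : Disjoint A B) :
    Indep (cylinderEvents A) (cylinderEvents B) (Measure.infinitePi μ) := by
  have hiIndep := iIndepFun_infinitePi (P := μ) (X := fun _ x => x) fun _ => measurable_id
  rw [iIndepFun_iff_iIndep] at hiIndep
  exact indep_iSup_of_disjoint (fun i => (measurable_pi_apply i).comap_le) hiIndep h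

theorem isDependentOfRange_map_infinitePi (μ : Site d → Measure Y)
    [∀ i, IsProbabilityMeasure (μ i)] {G : (Site d → Y) → (Site d → S)} (hG : Measurable G)
    {r l : ℕ} (hdep : ∀ i, DependsOn (fun y => G y i) {j | latticeDist j i ≤ r})
    (hl : 2 * r ≤ l) : IsDependentOfRange l ((Measure.infinitePi μ).map G) := by
  intro A B hAB
  have : Nonempty (Site d → Y) := nonempty_of_isProbabilityMeasure (Measure.infinitePi μ)
  let N (D : Set (Site d)) : Set (Site d) := {j | ∃ a ∈ D, latticeDist j a ≤ r}
  have hdisj : Disjoint (N A) (N B) := by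
    refine Set.disjoint_left.2 ?_
    rintro j ⟨a, ha, hja⟩ ⟨b, hb, hjb⟩
    have hab := hAB a ha b hb
    have htri := latticeDist_triangle a j b
    rw [latticeDist_comm] at hja
    omega
  have hres (D : Set (Site d)) : Measurable fun x : Site d → S => D.domRestrict x :=
    measurable_pi_iff.2 fun i => measurable_pi_apply _
  have hpre (D : Set (Site d)) (t : Set (D → S)) (ht : MeasurableSet t) :
      MeasurableSet[cylinderEvents (N D)] (G ⁻¹' (D.domRestrict ⁻¹' t)) := by
    refine measurable_cylinderEvents_of_dependsOn ((hres D).comp hG) (fun y y' hyy' => ?_) ht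
    exact funext fun a => hdep a fun j hj => hyy' j ⟨a, a.2, hj⟩
  rw [indepFun_iff_measure_inter_preimage_eq_mul]
  intro t u ht hu
  rw [Measure.map_apply hG ((hres A ht).inter (hres B hu)), Measure.map_apply hG (hres A ht),
    Measure.map_apply hG (hres B hu)]
  exact (Indep_iff _ _ _).1 (indep_cylinderEvents_infinitePi μ hdisj) _ _ (hpre A t ht)
    (hpre B u hu)

theorem isDependentOfRange_infinitePi (μ : Site d → Measure S) [∀ i, IsProbabilityMeasure (μ i)]
    (l : ℕ) : IsDependentOfRange l (Measure.infinitePi μ) := by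
  have h := isDependentOfRange_map_infinitePi μ measurable_id (r := 0) (l := l)
    (fun i y y' hyy' => hyy' i (latticeDist_self i).le) (by omega)
  rwa [Measure.map_id] at h

end FiniteDependence

/-! ### Total variation -/

section TotalVariation

variable {Ω X : Type*} [MeasurableSpace Ω] [MeasurableSpace X]

theorem tvDistance_le {μ ν : Measure X} {b : ℝ}
    (h : ∀ A, MeasurableSet A → |μ.real A - ν.real A| ≤ b) : tvDistance μ ν ≤ b := by
  have : Nonempty {A : Set X // MeasurableSet A} := ⟨⟨∅, MeasurableSet.empty⟩⟩
  exact ciSup_le fun A => h A.1 A.2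

theorem tvDistance_self (μ : Measure X) : tvDistance μ μ = 0 := by
  have : Nonempty {A : Set X // MeasurableSet A} := ⟨⟨∅, MeasurableSet.empty⟩⟩
  simp [tvDistance]

theorem tvDistance_le_one (μ ν : Measure X) [IsProbabilityMeasure μ] [IsProbabilityMeasure ν] :
    tvDistance μ ν ≤ 1 := by
  refine tvDistance_le fun A _ => abs_sub_le_iff.2 ⟨?_, ?_⟩
  · linarith [measureReal_le_one (μ := μ) (s := A), measureReal_nonneg (μ := ν) (s := A)]
  · linarith [measureReal_le_one (μ := ν) (s := A), measureReal_nonneg (μ := μ) (s := A)]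

theorem tvDistance_map_le (P : Measure Ω) [IsFiniteMeasure P] {f g : Ω → X} (hf : Measurable f)
    (hg : Measurable g) : tvDistance (P.map f) (P.map g) ≤ P.real {ω | f ω ≠ g ω} := by
  refine tvDistance_le fun A hA => ?_
  rw [map_measureReal_apply hf hA, map_measureReal_apply hg hA]
  have hle {f g : Ω → X} : P.real (f ⁻¹' A) ≤ P.real (g ⁻¹' A) + P.real {ω | f ω ≠ g ω} := by
    refine (measureReal_mono fun ω hω => ?_).trans (measureReal_union_le _ _)
    by_cases h : f ω = g ω
    · exact Or.inl (by simpa only [Set.mem_preimage, h] using hω)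
    · exact Or.inr h
  have hfg := hle (f := f) (g := g)
  have hgf := hle (f := g) (g := f)
  simp only [ne_comm (a := g _)] at hgf
  exact abs_sub_le_iff.2 ⟨by linarith, by linarith⟩

variable {d : ℕ} {S : Type*} [MeasurableSpace S]

instance isProbabilityMeasure_marginal (μ : Measure (Site d → S)) [IsProbabilityMeasure μ]
    (Λ : Finset (Site d)) : IsProbabilityMeasure (marginal μ Λ) :=
  Measure.isProbabilityMeasure_map (Finset.measurable_restrict Λ).aemeasurable

theorem tvDistance_marginal_map_le (P : Measure Ω) [IsFiniteMeasure P] {f g : Ω → Site d → S}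
    (hf : Measurable f) (hg : Measurable g) (Λ : Finset (Site d)) :
    tvDistance (marginal (P.map f) Λ) (marginal (P.map g) Λ) ≤
      ∑ i ∈ Λ, P.real {ω | f ω i ≠ g ω i} := by
  have hres : Measurable fun x : Site d → S => Λ.restrict x := Finset.measurable_restrict Λ
  rw [marginal, marginal, Measure.map_map hres hf, Measure.map_map hres hg]
  calc _ ≤ P.real {ω | Λ.restrict (f ω) ≠ Λ.restrict (g ω)} :=
        tvDistance_map_le P (hres.comp hf) (hres.comp hg)
    _ ≤ P.real (⋃ i ∈ Λ, {ω | f ω i ≠ g ω i}) := by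
        refine measureReal_mono (fun ω hω => ?_) (measure_ne_top _ _)
        obtain ⟨i, hi⟩ := Function.ne_iff.1 hω
        exact Set.mem_biUnion i.2 hi
    _ ≤ _ := measureReal_biUnion_finset_le _ _

theorem pi_map_eval_of_subsingleton {ι : Type*} [Fintype ι] [Subsingleton ι]
    (μ : Measure (ι → S)) [IsProbabilityMeasure μ] : Measure.pi (fun i => μ.map (· i)) = μ := by
  have (i : ι) : IsProbabilityMeasure (μ.map (· i)) :=
    Measure.isProbabilityMeasure_map (measurable_pi_apply i).aemeasurable
  refine Measure.pi_eq fun t ht => ?_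
  rcases isEmpty_or_nonempty ι with _ | ⟨⟨i⟩⟩
  · rw [Fintype.prod_empty, Set.eq_univ_of_forall (s := Set.univ.pi t) fun _ i => isEmptyElim i,
      measure_univ]
  · have : Unique ι := uniqueOfSubsingleton i
    rw [Fintype.prod_unique, Measure.map_apply (measurable_pi_apply _) (ht _)]
    congr 1
    ext x
    simp [Unique.forall_iff]

theorem marginal_infinitePi_map_eval_of_card_le_one (μ : Measure (Site d → S))
    [IsProbabilityMeasure μ] {Λ : Finset (Site d)} (hΛ : Λ.card ≤ 1) :
    marginal (Measure.infinitePi fun i => μ.map (· i)) Λ = marginal μ Λ := by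
  have (i : Site d) : IsProbabilityMeasure (μ.map (· i)) :=
    Measure.isProbabilityMeasure_map (measurable_pi_apply i).aemeasurable
  have : Subsingleton Λ := Finset.card_le_one_iff_subsingleton_coe.1 hΛ
  have heval (i : Λ) : (marginal μ Λ).map (· i) = μ.map (· (i : Site d)) :=
    Measure.map_map (measurable_pi_apply i) (Finset.measurable_restrict Λ)
  rw [← pi_map_eval_of_subsingleton (marginal μ Λ)]
  simp only [heval]
  exact Measure.infinitePi_map_restrict _

-- The product field has the right marginals on single sites, and on larger sets the bound is
-- at least `1`.
theorem tvDistance_marginal_infinitePi_map_eval_le (μ : Measure (Site d → S))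
    [IsProbabilityMeasure μ] (Λ : Finset (Site d)) :
    tvDistance (marginal μ Λ) (marginal (Measure.infinitePi fun i => μ.map (· i)) Λ) ≤
      Λ.card * (1 / 2 : ℝ) := by
  have (i : Site d) : IsProbabilityMeasure (μ.map (· i)) :=
    Measure.isProbabilityMeasure_map (measurable_pi_apply i).aemeasurable
  rcases Nat.lt_or_ge 1 Λ.card with hΛ | hΛ
  · have hcard : (2 : ℝ) ≤ Λ.card := by exact_mod_cast hΛ
    exact (tvDistance_le_one _ _).trans (by linarith)
  · rw [marginal_infinitePi_map_eval_of_card_le_one μ hΛ, tvDistance_self]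
    positivity

end TotalVariation

/-! ### Approximation of finitary factors by finitely dependent fields -/

section TruncatedCoding

variable {d : ℕ} {S Y : Type*}

/-- The coding that reads only the coordinates at distance at most `r`, the others being replaced
by the constant `o`. -/
def truncatedCoding (F : (Site d → Y) → (Site d → S)) (o : Y) (r : ℕ) (y : Site d → Y) :
    Site d → S :=
  fun i => F (fun j => if latticeDist j i ≤ r then y j else o) i

theorem truncatedCoding_eq_of_codingRadius_lt {F : (Site d → Y) → (Site d → S)} (o : Y) {r : ℕ}
    {i : Site d} {y : Site d → Y} (h : codingRadius F i y < (r + 1 : ℕ)) :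
    truncatedCoding F o r y i = F y i := by
  simp only [codingRadius, iInf_lt_iff] at h
  obtain ⟨r', hr', hlt⟩ := h
  have hle : r' ≤ r := Nat.lt_succ_iff.1 (Nat.cast_lt.1 hlt)
  exact (hr' _ fun j hj => if_pos (hj.trans hle)).symm

theorem truncatedCoding_shiftConfig {F : (Site d → Y) → (Site d → S)}
    (hF : ∀ (k : Site d) (y : Site d → Y), F (shiftConfig k y) = shiftConfig k (F y))
    (o : Y) (r : ℕ) (k : Site d) (y : Site d → Y) :
    truncatedCoding F o r (shiftConfig k y) = shiftConfig k (truncatedCoding F o r y) := by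
  ext1 i
  change F _ i = F _ (k + i)
  have hshift : (fun j => if latticeDist j i ≤ r then shiftConfig k y j else o) =
      shiftConfig k fun j => if latticeDist j (k + i) ≤ r then y j else o := by
    ext1 j
    simp only [shiftConfig, latticeDist_add_left]
  rw [hshift, hF]
  rfl

theorem dependsOn_truncatedCoding (F : (Site d → Y) → (Site d → S)) (o : Y) (r : ℕ) (i : Site d) :
    DependsOn (fun y => truncatedCoding F o r y i) {j | latticeDist j i ≤ r} := by
  intro y y' hyy'
  refine congrArg (F · i) (funext fun j => ?_)
  split_ifs with hj
  exacts [hyy' j hj, rfl]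

variable [MeasurableSpace Y]

theorem measure_ne_truncatedCoding_le (ν : Measure Y) [IsProbabilityMeasure ν]
    {F : (Site d → Y) → (Site d → S)}
    (hF : ∀ (k : Site d) (y : Site d → Y), F (shiftConfig k y) = shiftConfig k (F y))
    (o : Y) (r : ℕ) (i : Site d) :
    (Measure.infinitePi fun _ : Site d => ν) {y | F y i ≠ truncatedCoding F o r y i} ≤
      (Measure.infinitePi fun _ : Site d => ν) {y | ((r + 1 : ℕ) : ℕ∞) ≤ codingRadius F 0 y} := by
  set E := {y | ((r + 1 : ℕ) : ℕ∞) ≤ codingRadius F 0 y}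
  calc _ ≤ (Measure.infinitePi fun _ : Site d => ν) (shiftConfig i ⁻¹' E) := by
        refine measure_mono fun y hy => ?_
        by_contra hlt
        have heq := truncatedCoding_eq_of_codingRadius_lt o (not_le.1 hlt)
        rw [truncatedCoding_shiftConfig hF, hF] at heq
        simp only [shiftConfig, add_zero] at heq
        exact hy heq.symm
    _ ≤ (Measure.infinitePi fun _ : Site d => ν).map (shiftConfig i) E :=
        Measure.le_map_apply (measurable_shiftConfig i).aemeasurable _
    _ = _ := by rw [infinitePi_map_shiftConfig]

variable [MeasurableSpace S]

theorem measurable_truncatedCoding {F : (Site d → Y) → (Site d → S)} (hF : Measurable F)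
    (o : Y) (r : ℕ) : Measurable (truncatedCoding F o r) := by
  refine measurable_pi_iff.2 fun i => (measurable_pi_apply i).comp (hF.comp ?_)
  refine measurable_pi_iff.2 fun j => ?_
  split_ifs
  exacts [measurable_pi_apply j, measurable_const]

theorem tvDistance_marginal_truncatedCoding_le {ν : Measure Y} [IsProbabilityMeasure ν]
    {F : (Site d → Y) → (Site d → S)} {μ : Measure (Site d → S)} (hF : IsCoding ν μ F) (o : Y)
    (r : ℕ) (Λ : Finset (Site d)) :
    tvDistance (marginal μ Λ)
        (marginal ((Measure.infinitePi fun _ : Site d => ν).map (truncatedCoding F o r)) Λ) ≤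
      Λ.card * (Measure.infinitePi fun _ : Site d => ν).real
        {y | ((r + 1 : ℕ) : ℕ∞) ≤ codingRadius F 0 y} := by
  rw [← hF.map_eq, ← nsmul_eq_mul]
  exact (tvDistance_marginal_map_le _ hF.measurable
    (measurable_truncatedCoding hF.measurable o r) Λ).trans <| Finset.sum_le_card_nsmul _ _ _
      fun i _ => ENNReal.toReal_mono (measure_ne_top _ _)
        (measure_ne_truncatedCoding_le ν hF.commutes o r i)

theorem exists_forall_ge_mul_exp_half_le {C c : ℝ} (hC : 0 < C) (hc : 0 < c) :
    ∃ m : ℕ, ∀ l : ℕ, m ≤ l →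
      C * Real.exp (-c * (l / 2 + 1 : ℕ)) ≤ Real.exp (-(c / 4) * l) := by
  obtain ⟨m, hm⟩ := exists_nat_gt (4 * Real.log C / c)
  refine ⟨m, fun l hl => ?_⟩
  have hhalf : (l : ℝ) / 2 ≤ (l / 2 + 1 : ℕ) := by
    rw [div_le_iff₀ two_pos]
    exact_mod_cast (by omega : l ≤ (l / 2 + 1) * 2)
  have hlog : Real.log C ≤ c / 4 * l := by
    have : 4 * Real.log C / c < l := hm.trans_le (by exact_mod_cast hl)
    rw [div_lt_iff₀ hc] at this
    linarith
  have hmul := mul_le_mul_of_nonneg_left hhalf hc.le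
  rw [← Real.exp_log hC, ← Real.exp_add, Real.exp_le_exp]
  linarith

theorem IsFFIIDWithExpTails.exists_finitely_dependent_approx_of_le {μ : Measure (Site d → S)}
    (h : IsFFIIDWithExpTails μ) :
    ∃ c : ℝ, 0 < c ∧ ∃ m : ℕ, ∀ l : ℕ, m ≤ l → ∃ ν : Measure (Site d → S),
      IsProbabilityMeasure ν ∧ IsDependentOfRange l ν ∧
      ∀ Λ : Finset (Site d),
        tvDistance (marginal μ Λ) (marginal ν Λ) ≤ (Λ.card : ℝ) * Real.exp (-c * l) := by
  obtain ⟨Y, _, ν, _, F, hF, -, C, hC, c, hc, htail⟩ := h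
  obtain ⟨o⟩ : Nonempty Y := nonempty_of_isProbabilityMeasure ν
  obtain ⟨m, hm⟩ := exists_forall_ge_mul_exp_half_le hC hc
  refine ⟨c / 4, by positivity, m, fun l hl => ?_⟩
  have hmeas := measurable_truncatedCoding hF.measurable o (l / 2)
  refine ⟨_, Measure.isProbabilityMeasure_map hmeas.aemeasurable,
    isDependentOfRange_map_infinitePi (fun _ => ν) hmeas (dependsOn_truncatedCoding F o (l / 2))
      (Nat.mul_div_le l 2), fun Λ => ?_⟩
  refine (tvDistance_marginal_truncatedCoding_le hF o (l / 2) Λ).trans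
    (mul_le_mul_of_nonneg_left ?_ (Nat.cast_nonneg _))
  exact (ENNReal.toReal_le_of_le_ofReal (by positivity) (htail (l / 2 + 1))).trans (hm l hl)

theorem IsFFIIDWithExpTails.exists_finitely_dependent_approx {μ : Measure (Site d → S)}
    [IsProbabilityMeasure μ] (h : IsFFIIDWithExpTails μ) :
    ∃ c : ℝ, 0 < c ∧ ∀ l : ℕ, ∃ ν : Measure (Site d → S),
      IsProbabilityMeasure ν ∧ IsDependentOfRange l ν ∧
      ∀ Λ : Finset (Site d),
        tvDistance (marginal μ Λ) (marginal ν Λ) ≤ (Λ.card : ℝ) * Real.exp (-c * l) := by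
  obtain ⟨c, hc, m, hlarge⟩ := h.exists_finitely_dependent_approx_of_le
  refine ⟨min c (Real.log 2 / (m + 1)), lt_min hc (by positivity), fun l => ?_⟩
  by_cases hl : m ≤ l
  · obtain ⟨ν, hprob, hdep, htv⟩ := hlarge l hl
    refine ⟨ν, hprob, hdep, fun Λ => (htv Λ).trans ?_⟩
    gcongr
    exact min_le_left _ _
  · have (i : Site d) : IsProbabilityMeasure (μ.map (· i)) :=
      Measure.isProbabilityMeasure_map (measurable_pi_apply i).aemeasurable
    refine ⟨Measure.infinitePi fun i => μ.map (· i), inferInstance,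
      isDependentOfRange_infinitePi _ l, fun Λ => ?_⟩
    refine (tvDistance_marginal_infinitePi_map_eval_le μ Λ).trans
      (mul_le_mul_of_nonneg_left ?_ (Nat.cast_nonneg _))
    have hexponent : min c (Real.log 2 / (m + 1)) * l ≤ Real.log 2 := by
      calc min c (Real.log 2 / (m + 1)) * l ≤ Real.log 2 / (m + 1) * (m + 1) := by
            gcongr
            · exact min_le_right _ _
            · exact_mod_cast (by omega : l ≤ m + 1)
        _ = Real.log 2 := by field_simp
    calc (1 / 2 : ℝ) = Real.exp (-Real.log 2) := by
          rw [Real.exp_neg, Real.exp_log two_pos, one_div]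
      _ ≤ _ := by
          rw [Real.exp_le_exp, neg_mul]
          exact neg_le_neg hexponent

end TruncatedCoding

/-! ### Weighted averages of marginals -/

section LmarginalAverage

variable {ι : Type*} [DecidableEq ι] {X : ι → Type*} [∀ i, MeasurableSpace (X i)]

/-- The average of `f` over the coordinates in `Λ`, the other coordinates being fixed, for the
measure with density proportional to `w` with respect to the product of the `ρ i`. -/
def lmarginalAverage (ρ : ∀ i, Measure (X i)) (w : (∀ i, X i) → ℝ≥0∞) (Λ : Finset ι)
    (f : (∀ i, X i) → ℝ≥0∞) (ξ : ∀ i, X i) : ℝ≥0∞ :=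
  (∫⋯∫⁻_Λ, w * f ∂ρ) ξ / (∫⋯∫⁻_Λ, w ∂ρ) ξ

variable {ρ : ∀ i, Measure (X i)} {w w' c f : (∀ i, X i) → ℝ≥0∞} {Λ V : Finset ι}

theorem dependsOn_lmarginalAverage : DependsOn (lmarginalAverage ρ w Λ f) (Λ : Set ι)ᶜ := by
  intro x y hxy
  simp only [lmarginalAverage, lmarginal_congr ρ _ hxy]

theorem dependsOn_lmarginalAverage_of_dependsOn {Δ : Set ι} (hw : DependsOn w Δ)
    (hf : DependsOn f Δ) : DependsOn (lmarginalAverage ρ w Λ f) Δ := by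
  have hwf : DependsOn (w * f) Δ := fun x y h => by rw [Pi.mul_apply, hw h, hf h, Pi.mul_apply]
  intro ξ η h
  rw [lmarginalAverage, lmarginalAverage, dependsOn_lmarginal hwf h, dependsOn_lmarginal hw h]

theorem measurable_lmarginalAverage [∀ i, SigmaFinite (ρ i)] (hw : Measurable w)
    (hf : Measurable f) : Measurable (lmarginalAverage ρ w Λ f) :=
  ((hw.mul hf).lmarginal ρ).div (hw.lmarginal ρ)

theorem lmarginal_mul_lmarginalAverage (hw : Measurable w)
    (hw₀ : ∀ ξ, (∫⋯∫⁻_Λ, w ∂ρ) ξ ≠ 0) (hw_top : ∀ ξ, (∫⋯∫⁻_Λ, w ∂ρ) ξ ≠ ⊤) :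
    ∫⋯∫⁻_Λ, w * lmarginalAverage ρ w Λ f ∂ρ = ∫⋯∫⁻_Λ, w * f ∂ρ := by
  ext ξ
  rw [mul_comm w, lmarginal_mul_of_dependsOn ρ Λ hw dependsOn_lmarginalAverage]
  exact ENNReal.div_mul_cancel (hw₀ ξ) (hw_top ξ)

theorem lmarginal_mul_of_subset [∀ i, SigmaFinite (ρ i)] (h : Λ ⊆ V) (hw : Measurable w)
    (hf : Measurable f) (hc : Measurable c) (hcΛ : DependsOn c (Λ : Set ι)ᶜ) :
    ∫⋯∫⁻_V, c * w * f ∂ρ = ∫⋯∫⁻_V \ Λ, c * ∫⋯∫⁻_Λ, w * f ∂ρ ∂ρ := by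
  conv_lhs => rw [← Finset.sdiff_union_of_subset h]
  rw [lmarginal_union _ _ ((hc.mul hw).mul hf) Finset.sdiff_disjoint, mul_assoc,
    lmarginal_mul_of_dependsOn ρ Λ (hw.mul hf) hcΛ]

theorem lmarginalAverage_lmarginalAverage_of_subset [∀ i, SigmaFinite (ρ i)] (h : Λ ⊆ V)
    (hw : Measurable w) (hf : Measurable f) (hc : Measurable c) (hcΛ : DependsOn c (Λ : Set ι)ᶜ)
    (hw₀ : ∀ ξ, (∫⋯∫⁻_Λ, w ∂ρ) ξ ≠ 0) (hw_top : ∀ ξ, (∫⋯∫⁻_Λ, w ∂ρ) ξ ≠ ⊤) :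
    lmarginalAverage ρ (c * w) V (lmarginalAverage ρ w Λ f) = lmarginalAverage ρ (c * w) V f := by
  ext ξ
  rw [lmarginalAverage, lmarginalAverage,
    lmarginal_mul_of_subset h hw (measurable_lmarginalAverage hw hf) hc hcΛ,
    lmarginal_mul_lmarginalAverage hw hw₀ hw_top, ← lmarginal_mul_of_subset h hw hf hc hcΛ]

end LmarginalAverage

/-! ### The Hamiltonian -/

section Hamiltonian

variable {d : ℕ} {L ε : ℝ}

/-- The single spin space `[-L, L]`. -/
abbrev Spin (L : ℝ) : Type := Set.Icc (-L) L

theorem abs_spin_le (s : Spin L) : |s.1| ≤ L := abs_le.2 s.2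

theorem measurable_hamiltonian (Λ : Finset (Site d)) :
    Measurable fun x : Site d → Spin L => hamiltonian ε Λ fun i => (x i).1 := by
  unfold hamiltonian
  fun_prop

theorem exists_abs_hamiltonian_le (ε L : ℝ) (Λ : Finset (Site d)) :
    ∃ C, ∀ x : Site d → Spin L, |hamiltonian ε Λ fun i => (x i).1| ≤ C := by
  refine ⟨1 / 2 * ∑ _i ∈ Λ, L ^ 2 + |ε / (2 * d)| * ∑ k : Fin d,
    ∑ _i ∈ Λ ∪ Λ.image (fun j => j - Pi.single k 1), L * L, fun x => ?_⟩
  unfold hamiltonian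
  refine (abs_sub _ _).trans ?_
  rw [abs_mul, abs_mul, abs_of_pos (by norm_num : (0 : ℝ) < 1 / 2)]
  gcongr
  · refine (Finset.abs_sum_le_sum_abs _ _).trans (Finset.sum_le_sum fun i _ => ?_)
    rw [abs_pow]
    exact pow_le_pow_left₀ (abs_nonneg _) (abs_spin_le _) 2
  · refine (Finset.abs_sum_le_sum_abs _ _).trans (Finset.sum_le_sum fun k _ => ?_)
    refine (Finset.abs_sum_le_sum_abs _ _).trans (Finset.sum_le_sum fun i _ => ?_)
    rw [abs_mul]
    exact mul_le_mul (abs_spin_le _) (abs_spin_le _) (abs_nonneg _)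
      ((abs_nonneg _).trans (abs_spin_le (x i)))

theorem hamiltonian_sub_eq_of_subset {Λ V : Finset (Site d)} (h : Λ ⊆ V) (x : Site d → ℝ) :
    hamiltonian ε V x - hamiltonian ε Λ x =
      1 / 2 * ∑ i ∈ V \ Λ, x i ^ 2 - ε / (2 * d) * ∑ k : Fin d,
        ∑ i ∈ (V ∪ V.image (fun j => j - Pi.single k 1)) \
          (Λ ∪ Λ.image (fun j => j - Pi.single k 1)), x i * x (i + Pi.single k 1) := by
  have hpairs (k : Fin d) :
      Λ ∪ Λ.image (fun j => j - Pi.single k 1) ⊆ V ∪ V.image (fun j => j - Pi.single k 1) :=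
    Finset.union_subset_union h (Finset.image_subset_image h)
  simp only [Finset.sum_sdiff_eq_sub h, Finset.sum_sdiff_eq_sub (hpairs _),
    Finset.sum_sub_distrib, hamiltonian]
  ring

theorem dependsOn_hamiltonian_sub {Λ V : Finset (Site d)} (h : Λ ⊆ V) :
    DependsOn (fun x => hamiltonian ε V x - hamiltonian ε Λ x) (Λ : Set (Site d))ᶜ := by
  intro x y hxy
  have hxy' (i : Site d) (hi : i ∉ Λ) : x i = y i := hxy i hi
  simp only [hamiltonian_sub_eq_of_subset h]
  congr 2
  · refine Finset.sum_congr rfl fun i hi => ?_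
    rw [hxy' i (Finset.mem_sdiff.1 hi).2]
  · refine Finset.sum_congr rfl fun k _ => Finset.sum_congr rfl fun i hi => ?_
    simp only [Finset.mem_sdiff, Finset.mem_union, Finset.mem_image, not_or, not_exists,
      not_and] at hi
    rw [hxy' i hi.2.1,
      hxy' (i + Pi.single k 1) fun hmem => hi.2.2 _ hmem (add_sub_cancel_right _ _)]

/-- The field `ε / (2d) ∑_{j ∼ i} x_j` seen by the spin at `i`. -/
def localField (ε : ℝ) (i : Site d) (x : Site d → Spin L) : ℝ :=
  ε / (2 * d) * ∑ k : Fin d, ((x (i + Pi.single k 1)).1 + (x (i - Pi.single k 1)).1)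

theorem hamiltonian_singleton_update (i : Site d) (x : Site d → Spin L) (z : Spin L) :
    hamiltonian ε {i} (fun j => (Function.update x i z j).1) =
      z.1 ^ 2 / 2 - localField ε i x * z.1 := by
  have hbonds (k : Fin d) : ∑ j ∈ ({i} : Finset (Site d)) ∪
      ({i} : Finset (Site d)).image (fun j => j - Pi.single k 1),
      (Function.update x i z j).1 * (Function.update x i z (j + Pi.single k 1)).1 =
      ((x (i + Pi.single k 1)).1 + (x (i - Pi.single k 1)).1) * z.1 := by
    have hi : i - Pi.single k 1 ≠ i := by simp [sub_eq_self]
    have hi' : i + Pi.single k 1 ≠ i := by simp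
    rw [Finset.image_singleton, Finset.sum_union (Finset.disjoint_singleton.2 hi.symm),
      Finset.sum_singleton, Finset.sum_singleton, sub_add_cancel, Function.update_self,
      Function.update_of_ne hi, Function.update_of_ne hi']
    ring
  rw [hamiltonian, localField]
  simp only [hbonds, ← Finset.sum_mul, Finset.sum_singleton, Function.update_self]
  ring

theorem abs_localField_le (i : Site d) (x : Site d → Spin L) : |localField ε i x| ≤ |ε| * L := by
  have hL : 0 ≤ L := (abs_nonneg _).trans (abs_spin_le (x i))
  have hsum : |∑ k : Fin d, ((x (i + Pi.single k 1)).1 + (x (i - Pi.single k 1)).1)| ≤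
      d * (L + L) := by
    refine (Finset.abs_sum_le_sum_abs _ _).trans ?_
    refine (Finset.sum_le_card_nsmul _ _ (L + L) fun k _ =>
      (abs_add_le _ _).trans (add_le_add (abs_spin_le _) (abs_spin_le _))).trans_eq ?_
    rw [Finset.card_univ, Fintype.card_fin, nsmul_eq_mul]
  rw [localField, abs_mul, abs_div]
  rcases Nat.eq_zero_or_pos d with rfl | hd
  · simpa using mul_nonneg (abs_nonneg ε) hL
  · rw [abs_of_pos (by positivity : (0 : ℝ) < 2 * d)]
    calc _ ≤ |ε| / (2 * d) * (d * (L + L)) := by gcongr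
      _ = |ε| * L := by field_simp; ring

theorem abs_localField_mul_le (i : Site d) (x : Site d → Spin L) (z : Spin L) :
    |localField ε i x * z.1| ≤ |ε| * L ^ 2 := by
  rw [abs_mul]
  calc |localField ε i x| * |z.1| ≤ |ε| * L * L :=
        mul_le_mul (abs_localField_le i x) (abs_spin_le z) (abs_nonneg _)
          ((abs_nonneg _).trans (abs_localField_le i x))
    _ = |ε| * L ^ 2 := by ring

end Hamiltonian

/-! ### The specification -/

section Specification

variable {d : ℕ} {L ε : ℝ}

/-- Lebesgue measure on the single spin space. -/
def spinVolume (L : ℝ) : Measure (Spin L) := (volume : Measure ℝ).comap Subtype.val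

theorem spinVolume_univ : spinVolume L Set.univ = ENNReal.ofReal (2 * L) := by
  rw [spinVolume, comap_subtype_coe_apply measurableSet_Icc, Set.image_univ, Subtype.range_coe,
    Real.volume_Icc]
  congr 1
  ring

instance isFiniteMeasure_spinVolume : IsFiniteMeasure (spinVolume L) :=
  ⟨spinVolume_univ.trans_lt ENNReal.ofReal_lt_top⟩

/-- The Boltzmann weight `exp (-H_Λ(x))`. -/
def boltzmann (ε : ℝ) (Λ : Finset (Site d)) (x : Site d → Spin L) : ℝ≥0∞ :=
  ENNReal.ofReal (Real.exp (-hamiltonian ε Λ fun i => (x i).1))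

theorem measurable_boltzmann (Λ : Finset (Site d)) : Measurable (boltzmann (L := L) ε Λ) :=
  (measurable_hamiltonian Λ).neg.exp.ennreal_ofReal

theorem exists_boltzmann_eq_mul {Λ V : Finset (Site d)} (h : Λ ⊆ V) :
    ∃ c : (Site d → Spin L) → ℝ≥0∞, Measurable c ∧ DependsOn c (Λ : Set (Site d))ᶜ ∧
      boltzmann ε V = c * boltzmann ε Λ := by
  refine ⟨fun x => ENNReal.ofReal (Real.exp (-(hamiltonian ε V (fun i => (x i).1) -
    hamiltonian ε Λ fun i => (x i).1))),
    ((measurable_hamiltonian V).sub (measurable_hamiltonian Λ)).neg.exp.ennreal_ofReal,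
    fun x y hxy => ?_, ?_⟩
  · have := dependsOn_hamiltonian_sub (ε := ε) h (x := fun i => (x i).1) (y := fun i => (y i).1)
      fun i hi => by rw [hxy i hi]
    simp only [this]
  · ext x
    rw [Pi.mul_apply, boltzmann, boltzmann, ← ENNReal.ofReal_mul (Real.exp_pos _).le,
      ← Real.exp_add]
    congr 2
    ring

theorem glue_eq_updateFinset (Λ : Finset (Site d)) (x : Λ → Spin L) (ξ : Site d → Spin L) :
    glue Λ x ξ = Function.updateFinset ξ Λ x := rfl

theorem measurable_glue (Λ : Finset (Site d)) (ξ : Site d → Spin L) :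
    Measurable fun x => glue Λ x ξ :=
  measurable_updateFinset (s := Λ) (x := ξ)

theorem dependsOn_glue (Λ : Finset (Site d)) (x : Λ → Spin L) :
    DependsOn (fun ξ : Site d → Spin L => glue Λ x ξ) (Λ : Set (Site d))ᶜ := by
  intro ξ η h
  ext1 i
  by_cases hi : i ∈ Λ
  · simp only [glue, hi, dite_true]
  · simp only [glue, hi, dite_false, h i hi]

theorem integrable_exp_neg_hamiltonian (Λ : Finset (Site d)) (ξ : Site d → Spin L) :
    Integrable (fun x => Real.exp (-hamiltonian ε Λ fun i => (glue Λ x ξ i).1))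
      (Measure.pi fun _ : Λ => spinVolume L) := by
  obtain ⟨C, hC⟩ := exists_abs_hamiltonian_le ε L Λ
  refine .of_bound (C := Real.exp C)
    ((measurable_hamiltonian Λ).comp (measurable_glue Λ ξ)).neg.exp.aestronglyMeasurable
    (.of_forall fun x => ?_)
  rw [Real.norm_eq_abs, Real.abs_exp]
  exact Real.exp_le_exp.2 ((neg_le_abs _).trans (hC _))

theorem lmarginal_boltzmann (Λ : Finset (Site d)) (ξ : Site d → Spin L) :
    (∫⋯∫⁻_Λ, boltzmann ε Λ ∂fun _ => spinVolume L) ξ = ENNReal.ofReal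
      (∫ x, Real.exp (-hamiltonian ε Λ fun i => (glue Λ x ξ i).1)
        ∂Measure.pi fun _ : Λ => spinVolume L) := by
  rw [ofReal_integral_eq_lintegral_ofReal (integrable_exp_neg_hamiltonian Λ ξ)
    (.of_forall fun x => (Real.exp_pos _).le)]
  simp only [lmarginal, boltzmann, glue_eq_updateFinset]

theorem lmarginal_boltzmann_ne_top (Λ : Finset (Site d)) (ξ : Site d → Spin L) :
    (∫⋯∫⁻_Λ, boltzmann ε Λ ∂fun _ => spinVolume L) ξ ≠ ⊤ := by
  rw [lmarginal_boltzmann]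
  exact ENNReal.ofReal_ne_top

variable [hL : Fact (0 < L)]

instance neZero_spinVolume : NeZero (spinVolume L) := by
  refine ⟨fun h => ?_⟩
  have huniv : spinVolume L Set.univ = 0 := by rw [h, Measure.coe_zero, Pi.zero_apply]
  rw [spinVolume_univ, ENNReal.ofReal_eq_zero] at huniv
  linarith [hL.out]

instance nonempty_spin : Nonempty (Spin L) := ⟨0, neg_nonpos.2 hL.out.le, hL.out.le⟩

instance neZero_pi_spinVolume (ι : Type*) [Fintype ι] :
    NeZero (Measure.pi fun _ : ι => spinVolume L) := by
  refine ⟨fun h => ?_⟩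
  have huniv : (Measure.pi fun _ : ι => spinVolume L) Set.univ = 0 := by
    rw [h, Measure.coe_zero, Pi.zero_apply]
  rw [Measure.pi_univ, Finset.prod_eq_zero_iff] at huniv
  obtain ⟨_, -, hzero⟩ := huniv
  exact NeZero.ne _ (Measure.measure_univ_eq_zero.1 hzero)

theorem lmarginal_boltzmann_ne_zero (Λ : Finset (Site d)) (ξ : Site d → Spin L) :
    (∫⋯∫⁻_Λ, boltzmann ε Λ ∂fun _ => spinVolume L) ξ ≠ 0 := by
  rw [lmarginal_boltzmann, Ne, ENNReal.ofReal_eq_zero, not_le]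
  exact integral_exp_pos (integrable_exp_neg_hamiltonian Λ ξ)

instance isProbabilityMeasure_truncatedSpec (Λ : Finset (Site d)) (ξ : Site d → Spin L) :
    IsProbabilityMeasure (truncatedSpec ε L Λ ξ) := by
  have : NeZero (Measure.pi fun _ : Λ => (volume : Measure ℝ).comap
      (Subtype.val : Set.Icc (-L) L → ℝ)) := neZero_pi_spinVolume Λ
  exact isProbabilityMeasure_tilted (integrable_exp_neg_hamiltonian Λ ξ)

theorem lintegral_truncatedSpec (Λ : Finset (Site d)) (ξ : Site d → Spin L)
    {f : (Site d → Spin L) → ℝ≥0∞} (hf : Measurable f) :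
    ∫⁻ x, f (glue Λ x ξ) ∂truncatedSpec ε L Λ ξ =
      lmarginalAverage (fun _ => spinVolume L) (boltzmann ε Λ) Λ f ξ := by
  have hpos := integral_exp_pos (integrable_exp_neg_hamiltonian (ε := ε) Λ ξ)
  have hm : Measurable fun x => boltzmann ε Λ (glue Λ x ξ) * f (glue Λ x ξ) :=
    ((measurable_boltzmann Λ).mul hf).comp (measurable_glue Λ ξ)
  rw [truncatedSpec, lintegral_tilted, lmarginalAverage, lmarginal_boltzmann,
    ENNReal.div_eq_inv_mul]
  change _ = _ * ∫⁻ x, boltzmann ε Λ (glue Λ x ξ) * f (glue Λ x ξ)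
    ∂Measure.pi fun _ : Λ => spinVolume L
  rw [← lintegral_const_mul _ hm]
  refine lintegral_congr fun x => ?_
  rw [← spinVolume, ENNReal.ofReal_div_of_pos hpos, ENNReal.div_eq_inv_mul, mul_assoc]
  rfl

end Specification

/-! ### The DLR equations as invariance under resampling -/

section GibbsKernel

variable {d : ℕ} {L ε : ℝ} [Fact (0 < L)]

theorem measurable_map_glue_truncatedSpec (Λ : Finset (Site d)) :
    Measurable[cylinderEvents (Λ : Set (Site d))ᶜ] fun ξ : Site d → Spin L =>
      (truncatedSpec ε L Λ ξ).map fun x => glue Λ x ξ := by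
  refine measurable_cylinderEvents_of_dependsOn
    (Measure.measurable_of_measurable_coe _ fun s hs => ?_) fun ξ η hξη => ?_
  · have hind : Measurable (s.indicator (1 : (Site d → Spin L) → ℝ≥0∞)) :=
      measurable_one.indicator hs
    simp only [← lintegral_indicator_one hs, lintegral_map hind (measurable_glue Λ _),
      lintegral_truncatedSpec Λ _ hind]
    exact measurable_lmarginalAverage (measurable_boltzmann Λ) hind
  · have hglue (x : Λ → Spin L) : glue Λ x ξ = glue Λ x η := dependsOn_glue Λ x hξη
    simp only [truncatedSpec, hglue]

/-- The kernel that resamples the spins in `Λ` from the specification. -/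
def gibbsKernel (ε L : ℝ) [Fact (0 < L)] (Λ : Finset (Site d)) :
    Kernel[cylinderEvents (Λ : Set (Site d))ᶜ, MeasurableSpace.pi]
      (Site d → Spin L) (Site d → Spin L) :=
  @Kernel.mk _ _ (cylinderEvents (Λ : Set (Site d))ᶜ) _
    (fun ξ => (truncatedSpec ε L Λ ξ).map fun x => glue Λ x ξ)
    (measurable_map_glue_truncatedSpec Λ)

theorem gibbsKernel_apply (Λ : Finset (Site d)) (ξ : Site d → Spin L) :
    gibbsKernel ε L Λ ξ = (truncatedSpec ε L Λ ξ).map fun x => glue Λ x ξ := rfl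

instance isMarkovKernel_gibbsKernel (Λ : Finset (Site d)) : IsMarkovKernel (gibbsKernel ε L Λ) :=
  ⟨fun ξ => Measure.isProbabilityMeasure_map (measurable_glue Λ ξ).aemeasurable⟩

theorem measurable_gibbsKernel (Λ : Finset (Site d)) : Measurable (gibbsKernel ε L Λ) :=
  (gibbsKernel ε L Λ).measurable.mono cylinderEvents_le_pi le_rfl

theorem lintegral_gibbsKernel (Λ : Finset (Site d)) (ξ : Site d → Spin L)
    {f : (Site d → Spin L) → ℝ≥0∞} (hf : Measurable f) :
    ∫⁻ x, f x ∂gibbsKernel ε L Λ ξ =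
      lmarginalAverage (fun _ => spinVolume L) (boltzmann ε Λ) Λ f ξ := by
  rw [gibbsKernel_apply, lintegral_map hf (measurable_glue Λ ξ), lintegral_truncatedSpec Λ ξ hf]

theorem gibbsKernel_restrict_preimage (Λ : Finset (Site d)) (ξ : Site d → Spin L)
    {A : Set (Λ → Spin L)} (hA : MeasurableSet A) :
    gibbsKernel ε L Λ ξ (Λ.restrict ⁻¹' A) = truncatedSpec ε L Λ ξ A := by
  rw [gibbsKernel_apply,
    Measure.map_apply (measurable_glue Λ ξ) (Finset.measurable_restrict Λ hA)]
  congr 1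
  ext x
  have : Λ.restrict (glue Λ x ξ) = x := by
    ext i
    simp [glue]
  simp only [Set.mem_preimage, this]

theorem isProper_gibbsKernel (Λ : Finset (Site d)) : (gibbsKernel ε L Λ).IsProper := by
  refine Kernel.IsProper.of_inter_eq_indicator_mul cylinderEvents_le_pi fun A hA B hB ξ => ?_
  have hglue (x : Λ → Spin L) : (glue Λ x ξ ∈ B) = (ξ ∈ B) :=
    dependsOn_mem_of_measurableSet_cylinderEvents hB fun i hi => dif_neg hi
  rw [gibbsKernel_apply, Measure.map_apply (measurable_glue Λ ξ) hA,
    Measure.map_apply (measurable_glue Λ ξ) (hA.inter (cylinderEvents_le_pi _ hB)),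
    Set.preimage_inter]
  by_cases hξ : ξ ∈ B <;> simp [Set.preimage, hglue, hξ]

theorem gibbsKernel_comp_gibbsKernel_of_subset {Λ V : Finset (Site d)} (h : Λ ⊆ V)
    (ξ : Site d → Spin L) : gibbsKernel ε L Λ ∘ₘ gibbsKernel ε L V ξ = gibbsKernel ε L V ξ := by
  obtain ⟨c, hc, hcΛ, hV⟩ := exists_boltzmann_eq_mul (ε := ε) (L := L) h
  refine Measure.ext fun s hs => ?_
  have hind : Measurable (s.indicator (1 : (Site d → Spin L) → ℝ≥0∞)) :=
    measurable_one.indicator hs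
  have hw := measurable_boltzmann (L := L) (ε := ε) Λ
  rw [Measure.bind_apply hs (measurable_gibbsKernel Λ).aemeasurable]
  simp only [← lintegral_indicator_one hs, lintegral_gibbsKernel _ _ hind]
  rw [lintegral_gibbsKernel V ξ (measurable_lmarginalAverage hw hind), hV,
    lmarginalAverage_lmarginalAverage_of_subset h hw hind hc hcΛ (lmarginal_boltzmann_ne_zero Λ)
      (lmarginal_boltzmann_ne_top Λ)]

theorem isTruncatedGibbs_iff_forall_gibbsKernel_comp_eq {μ : Measure (Site d → Spin L)}
    [IsProbabilityMeasure μ] :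
    IsTruncatedGibbs ε L μ ↔ ∀ Λ : Finset (Site d), gibbsKernel ε L Λ ∘ₘ μ = μ := by
  have hdlr (Λ : Finset (Site d)) (A : Set (Λ → Spin L)) (hA : MeasurableSet A) :
      μ⟦Λ.restrict ⁻¹' A | cylinderEvents (Λ : Set (Site d))ᶜ⟧ =ᵐ[μ]
          (fun ξ => (truncatedSpec ε L Λ ξ).real A) ↔
        ∀ B, MeasurableSet[cylinderEvents (Λ : Set (Site d))ᶜ] B →
          (gibbsKernel ε L Λ ∘ₘ μ) (Λ.restrict ⁻¹' A ∩ B) = μ (Λ.restrict ⁻¹' A ∩ B) := by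
    rw [← condExp_indicator_ae_eq_properKernel_iff cylinderEvents_le_pi (isProper_gibbsKernel Λ)
      (Finset.measurable_restrict Λ hA)]
    simp only [Measure.real, gibbsKernel_restrict_preimage Λ _ hA]
  refine ⟨fun h Λ => ?_, fun h => ⟨inferInstance, fun Λ A hA => ?_⟩⟩
  · refine (measure_ext_of_inter_cylinderEvents (Λ : Set (Site d)) fun A B hA hB => ?_).symm
    rw [cylinderEvents_eq_comap_domRestrict] at hA
    obtain ⟨A, hA, rfl⟩ := hA
    exact ((hdlr Λ A hA).1 (h.dlr Λ A hA) B hB).symm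
  · exact (hdlr Λ A hA).2 fun B _ => by rw [h Λ]

theorem lintegral_lintegral_gibbsKernel {μ : Measure (Site d → Spin L)} {Λ : Finset (Site d)}
    (hμ : gibbsKernel ε L Λ ∘ₘ μ = μ) {f : (Site d → Spin L) → ℝ≥0∞} (hf : Measurable f) :
    ∫⁻ ξ, ∫⁻ x, f x ∂gibbsKernel ε L Λ ξ ∂μ = ∫⁻ x, f x ∂μ := by
  rw [← Measure.lintegral_bind (measurable_gibbsKernel Λ).aemeasurable hf.aemeasurable, hμ]

end GibbsKernel

/-! ### Nearest neighbours -/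

section Neighbours

variable {d : ℕ} {L ε : ℝ}

/-- The nearest neighbours of a site. -/
def neighbours (i : Site d) : Finset (Site d) :=
  Finset.univ.image (fun k => i + Pi.single k 1) ∪ Finset.univ.image fun k => i - Pi.single k 1

theorem mem_neighbours {i j : Site d} :
    j ∈ neighbours i ↔ ∃ k, j = i + Pi.single k 1 ∨ j = i - Pi.single k 1 := by
  simp only [neighbours, Finset.mem_union, Finset.mem_image, Finset.mem_univ, true_and,
    exists_or, eq_comm]

theorem self_notMem_neighbours (i : Site d) : i ∉ neighbours i := by
  simp [mem_neighbours, sub_eq_self, eq_comm (a := i)]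

theorem card_insert_neighbours_le (i : Site d) : (insert i (neighbours i)).card ≤ 2 * d + 1 := by
  refine (Finset.card_insert_le _ _).trans (Nat.succ_le_succ ?_)
  calc (neighbours i).card ≤ _ := Finset.card_union_le _ _
    _ ≤ d + d := add_le_add (Finset.card_image_le.trans_eq (Finset.card_fin d))
        (Finset.card_image_le.trans_eq (Finset.card_fin d))
    _ = 2 * d := (two_mul d).symm

theorem neighbours_add (k i : Site d) : neighbours (k + i) = (neighbours i).image (k + ·) := by
  simp only [neighbours, Finset.image_union, Finset.image_image, Function.comp_def, add_assoc,
    add_sub_assoc]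

theorem latticeDist_le_one_of_mem_neighbours {i j : Site d} (h : j ∈ neighbours i) :
    latticeDist j i ≤ 1 := by
  have hsingle (k : Fin d) : ∑ l, ((Pi.single k 1 : Site d) l).natAbs = 1 := by
    rw [Fintype.sum_eq_single k fun l hl => by rw [Pi.single_eq_of_ne hl, Int.natAbs_zero],
      Pi.single_eq_same, Int.natAbs_one]
  obtain ⟨k, rfl | rfl⟩ := mem_neighbours.1 h <;> simp [latticeDist, hsingle]

theorem latticeDist_le_succ_of_mem {i j l : Site d} {n : ℕ} (hj : j ∈ insert i (neighbours i))
    (h : latticeDist l j ≤ n) : latticeDist l i ≤ n + 1 := by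
  rcases Finset.mem_insert.1 hj with rfl | hj
  · exact h.trans n.le_succ
  · exact (latticeDist_triangle l j i).trans
      (add_le_add h (latticeDist_le_one_of_mem_neighbours hj))

theorem localField_congr {i : Site d} {x y : Site d → Spin L}
    (h : ∀ j ∈ neighbours i, x j = y j) : localField ε i x = localField ε i y := by
  unfold localField
  congr 1
  refine Finset.sum_congr rfl fun k _ => ?_
  rw [h _ (mem_neighbours.2 ⟨k, .inl rfl⟩), h _ (mem_neighbours.2 ⟨k, .inr rfl⟩)]

theorem dependsOn_hamiltonian (ε : ℝ) (Λ : Finset (Site d)) :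
    DependsOn (hamiltonian ε Λ) (thickening Λ 1 : Set (Site d)) := by
  intro x y h
  have hsite (i : Site d) (hi : i ∈ Λ) : x i = y i :=
    h i (mem_thickening.2 ⟨i, hi, by simp [latticeDist_self]⟩)
  have hnear {i j : Site d} (hi : i ∈ Λ) (hj : j ∈ neighbours i) : x j = y j :=
    h j (mem_thickening.2 ⟨i, hi, latticeDist_le_one_of_mem_neighbours hj⟩)
  rw [hamiltonian, hamiltonian]
  congr 2
  · exact Finset.sum_congr rfl fun i hi => by rw [hsite i hi]
  · refine Finset.sum_congr rfl fun k _ => Finset.sum_congr rfl fun i hi => ?_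
    rcases Finset.mem_union.1 hi with hi | hi
    · rw [hsite i hi, hnear hi (mem_neighbours.2 ⟨k, .inl rfl⟩)]
    · obtain ⟨j, hj, rfl⟩ := Finset.mem_image.1 hi
      rw [sub_add_cancel, hsite j hj, hnear hj (mem_neighbours.2 ⟨k, .inr rfl⟩)]

theorem dependsOn_boltzmann (ε : ℝ) (Λ : Finset (Site d)) :
    DependsOn (boltzmann (L := L) ε Λ) (thickening Λ 1 : Set (Site d)) := by
  intro x y h
  rw [boltzmann, boltzmann, dependsOn_hamiltonian ε Λ fun i hi => by rw [h i hi]]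

end Neighbours

/-! ### Resampling a spin by rejection -/

section Resampling

variable {d : ℕ} {L ε : ℝ}

/-- The law of a free spin: the Gaussian law conditioned to `[-L, L]`. -/
def freeSpin (L : ℝ) : Measure (Spin L) := (spinVolume L).tilted fun z => -(z.1 ^ 2 / 2)

theorem integrable_exp_neg_sq (L : ℝ) :
    Integrable (fun z : Spin L => Real.exp (-(z.1 ^ 2 / 2))) (spinVolume L) := by
  refine .of_bound (C := 1) (by fun_prop) (.of_forall fun z => ?_)
  rw [Real.norm_eq_abs, Real.abs_exp, Real.exp_le_one_iff, neg_nonpos]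
  positivity

instance isProbabilityMeasure_freeSpin [Fact (0 < L)] : IsProbabilityMeasure (freeSpin L) :=
  isProbabilityMeasure_tilted (integrable_exp_neg_sq L)

/-- A proposed spin together with the variable in `[0, 1]` that decides about its acceptance. -/
abbrev Proposal (L : ℝ) : Type := Spin L × unitInterval

/-- The law of a proposal: a free spin and an independent uniform variable. -/
def proposalMeasure (L : ℝ) : Measure (Proposal L) := (freeSpin L).prod volume

instance isProbabilityMeasure_proposalMeasure [Fact (0 < L)] :
    IsProbabilityMeasure (proposalMeasure L) :=
  inferInstanceAs (IsProbabilityMeasure ((freeSpin L).prod volume))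

/-- The probability to accept the proposed spin `z` at the site `i`. The constant `|ε| L²` makes
it at most `1`. -/
def acceptance (ε : ℝ) (i : Site d) (x : Site d → Spin L) (z : Spin L) : ℝ :=
  Real.exp (localField ε i x * z.1 - |ε| * L ^ 2)

theorem acceptance_mem_unitInterval (i : Site d) (x : Site d → Spin L) (z : Spin L) :
    acceptance ε i x z ∈ unitInterval := by
  refine ⟨(Real.exp_pos _).le, ?_⟩
  rw [acceptance, Real.exp_le_one_iff, sub_nonpos]
  exact (le_abs_self _).trans (abs_localField_mul_le i x z)

theorem acceptance_congr {i : Site d} {x y : Site d → Spin L} (z : Spin L)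
    (h : ∀ j ∈ neighbours i, x j = y j) : acceptance ε i x z = acceptance ε i y z := by
  rw [acceptance, localField_congr h, acceptance]

theorem measurable_localField (i : Site d) : Measurable (localField (L := L) ε i) := by
  unfold localField
  fun_prop

theorem measurable_acceptance {α : Type*} [MeasurableSpace α] (i : Site d)
    {x : α → Site d → Spin L} {z : α → Spin L} (hx : Measurable x) (hz : Measurable z) :
    Measurable fun a => acceptance ε i (x a) (z a) := by
  have := (measurable_localField (ε := ε) i).comp hx
  unfold acceptance
  fun_prop

/-- The probability that a proposal at the site `i` is accepted. -/
def acceptanceProb (ε : ℝ) (i : Site d) (x : Site d → Spin L) : ℝ≥0∞ :=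
  ∫⁻ z, ENNReal.ofReal (acceptance ε i x z) ∂freeSpin L

theorem acceptanceProb_le_one [Fact (0 < L)] (i : Site d) (x : Site d → Spin L) :
    acceptanceProb ε i x ≤ 1 :=
  calc acceptanceProb ε i x ≤ ∫⁻ _, 1 ∂freeSpin L :=
        lintegral_mono fun z => ENNReal.ofReal_le_one.2 (acceptance_mem_unitInterval i x z).2
    _ = 1 := by rw [lintegral_one, measure_univ]

theorem measurable_ofReal_acceptance (i : Site d) (x : Site d → Spin L) :
    Measurable fun z => ENNReal.ofReal (acceptance ε i x z) :=
  (measurable_acceptance i measurable_const measurable_id).ennreal_ofReal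

theorem exists_lintegral_mul_acceptance_eq [Fact (0 < L)] (i : Site d) :
    ∃ c : ℝ≥0∞, ∀ (x : Site d → Spin L) (f : (Site d → Spin L) → ℝ≥0∞), Measurable f →
      ∫⁻ z, f (Function.update x i z) * ENNReal.ofReal (acceptance ε i x z) ∂freeSpin L =
        c * (∫⋯∫⁻_{i}, boltzmann ε {i} * f ∂fun _ => spinVolume L) x := by
  have hZ := integral_exp_pos (integrable_exp_neg_sq L)
  refine ⟨ENNReal.ofReal (Real.exp (-(|ε| * L ^ 2)) /
    ∫ z : Spin L, Real.exp (-(z.1 ^ 2 / 2)) ∂spinVolume L), fun x f hf => ?_⟩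
  have hm : Measurable fun z => boltzmann ε {i} (Function.update x i z) *
      f (Function.update x i z) :=
    ((measurable_boltzmann {i}).mul hf).comp (measurable_update x)
  rw [freeSpin, lintegral_tilted, lmarginal_singleton]
  simp only [Pi.mul_apply]
  rw [← lintegral_const_mul _ hm]
  refine lintegral_congr fun z => ?_
  rw [mul_left_comm, mul_comm, ← ENNReal.ofReal_mul (by positivity), boltzmann,
    hamiltonian_singleton_update, ← mul_assoc, ← ENNReal.ofReal_mul (by positivity),
    div_mul_eq_mul_div, div_mul_eq_mul_div, acceptance, ← Real.exp_add, ← Real.exp_add]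
  congr 4
  ring

theorem lintegral_mul_acceptance [Fact (0 < L)] (i : Site d) (x : Site d → Spin L)
    {f : (Site d → Spin L) → ℝ≥0∞} (hf : Measurable f) :
    ∫⁻ z, f (Function.update x i z) * ENNReal.ofReal (acceptance ε i x z) ∂freeSpin L =
      acceptanceProb ε i x * ∫⁻ y, f y ∂gibbsKernel ε L {i} x := by
  obtain ⟨c, hc⟩ := exists_lintegral_mul_acceptance_eq (L := L) (ε := ε) i
  have hprob : acceptanceProb ε i x =
      c * (∫⋯∫⁻_{i}, boltzmann ε {i} ∂fun _ => spinVolume L) x := by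
    simpa only [acceptanceProb, Pi.one_apply, one_mul, mul_one] using hc x 1 measurable_one
  rw [hc x f hf, hprob, lintegral_gibbsKernel _ _ hf, lmarginalAverage, mul_assoc,
    ENNReal.mul_div_cancel (lmarginal_boltzmann_ne_zero {i} x) (lmarginal_boltzmann_ne_top {i} x)]

/-- The spin at `i` after a proposal `v`, which is kept if it is rejected. -/
def resampledSpin (ε : ℝ) (i : Site d) (v : Proposal L) (x : Site d → Spin L) : Spin L :=
  if v.2.1 ≤ acceptance ε i x v.1 then v.1 else x i

theorem measurable_resampledSpin {α : Type*} [MeasurableSpace α] (i : Site d)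
    {v : α → Proposal L} {x : α → Site d → Spin L} (hv : Measurable v) (hx : Measurable x) :
    Measurable fun a => resampledSpin ε i (v a) (x a) := by
  unfold resampledSpin
  have hacc : Measurable fun a => acceptance ε i (x a) (v a).1 :=
    measurable_acceptance i hx hv.fst
  have hset : MeasurableSet {a | (v a).2.1 ≤ acceptance ε i (x a) (v a).1} :=
    measurableSet_le (by fun_prop) hacc
  exact Measurable.ite hset (by fun_prop) (by fun_prop)

theorem lintegral_unitInterval_ite {a : ℝ} (ha : a ∈ unitInterval) (b c : ℝ≥0∞) :
    (∫⁻ u : unitInterval, if u.1 ≤ a then b else c) =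
      b * ENNReal.ofReal a + c * (1 - ENNReal.ofReal a) := by
  have hs : MeasurableSet (Set.Iic (⟨a, ha⟩ : unitInterval)) := measurableSet_Iic
  have hb : ∫⁻ u in Set.Iic (⟨a, ha⟩ : unitInterval), (if u.1 ≤ a then b else c) =
      ∫⁻ _ in Set.Iic (⟨a, ha⟩ : unitInterval), b := setLIntegral_congr_fun hs fun u hu => if_pos hu
  have hc : ∫⁻ u in (Set.Iic (⟨a, ha⟩ : unitInterval))ᶜ, (if u.1 ≤ a then b else c) =
      ∫⁻ _ in (Set.Iic (⟨a, ha⟩ : unitInterval))ᶜ, c :=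
    setLIntegral_congr_fun hs.compl fun u hu => if_neg hu
  rw [← lintegral_add_compl _ hs, hb, hc, setLIntegral_const, setLIntegral_const,
    prob_compl_eq_one_sub hs, unitInterval.volume_Iic]

theorem lintegral_update_resampledSpin [Fact (0 < L)] (i : Site d) (x : Site d → Spin L)
    {f : (Site d → Spin L) → ℝ≥0∞} (hf : Measurable f) :
    ∫⁻ v, f (Function.update x i (resampledSpin ε i v x)) ∂proposalMeasure L =
      acceptanceProb ε i x * ∫⁻ y, f y ∂gibbsKernel ε L {i} x +
        (1 - acceptanceProb ε i x) * f x := by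
  have hacc := measurable_ofReal_acceptance (ε := ε) i x
  have hinner (z : Spin L) :
      ∫⁻ u : unitInterval, f (Function.update x i (resampledSpin ε i (z, u) x)) =
        f (Function.update x i z) * ENNReal.ofReal (acceptance ε i x z) +
          f x * (1 - ENNReal.ofReal (acceptance ε i x z)) := by
    rw [← lintegral_unitInterval_ite (acceptance_mem_unitInterval i x z)]
    refine lintegral_congr fun u => ?_
    simp only [resampledSpin, apply_ite (fun z => f (Function.update x i z)),
      Function.update_eq_self]
  have hmul : Measurable fun z =>
      f (Function.update x i z) * ENNReal.ofReal (acceptance ε i x z) :=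
    (hf.comp (measurable_update x)).mul hacc
  have hm : Measurable fun v : Proposal L => f (Function.update x i (resampledSpin ε i v x)) :=
    hf.comp ((measurable_update x).comp
      (measurable_resampledSpin i measurable_id measurable_const))
  have hprob : ∫⁻ z, (1 - ENNReal.ofReal (acceptance ε i x z)) ∂freeSpin L =
      1 - acceptanceProb ε i x := by
    rw [lintegral_sub hacc ((acceptanceProb_le_one i x).trans_lt ENNReal.one_lt_top).ne
      (.of_forall fun z => ENNReal.ofReal_le_one.2 (acceptance_mem_unitInterval i x z).2),
      lintegral_one, measure_univ, acceptanceProb]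
  rw [proposalMeasure, lintegral_prod _ hm.aemeasurable]
  simp only [hinner]
  rw [lintegral_add_left hmul,
    lintegral_const_mul _ (hacc.const_sub 1), hprob, lintegral_mul_acceptance i x hf,
    mul_comm (f x)]

theorem lintegral_lintegral_update_resampledSpin [Fact (0 < L)] {i : Site d}
    {μ : Measure (Site d → Spin L)} (hμ : gibbsKernel ε L {i} ∘ₘ μ = μ)
    {f : (Site d → Spin L) → ℝ≥0∞} (hf : Measurable f) :
    ∫⁻ x, ∫⁻ v, f (Function.update x i (resampledSpin ε i v x)) ∂proposalMeasure L ∂μ =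
      ∫⁻ x, f x ∂μ := by
  have hprob : Measurable[cylinderEvents ((({i} : Finset (Site d)) : Set (Site d))ᶜ)]
      (acceptanceProb (L := L) ε i) := by
    refine measurable_cylinderEvents_of_dependsOn
      (Measurable.lintegral_prod_right'
      (measurable_acceptance i measurable_fst measurable_snd).ennreal_ofReal) fun x y hxy => ?_
    have hacc (z : Spin L) : acceptance ε i x z = acceptance ε i y z :=
      acceptance_congr z fun j hj => hxy j fun hji =>
        self_notMem_neighbours i (Finset.mem_singleton.1 hji ▸ hj)
    simp only [acceptanceProb, hacc]
  have hprob' := hprob.mono cylinderEvents_le_pi le_rfl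
  have hkernel (x : Site d → Spin L) :
      acceptanceProb ε i x * ∫⁻ y, f y ∂gibbsKernel ε L {i} x =
        ∫⁻ y, acceptanceProb ε i y * f y ∂gibbsKernel ε L {i} x :=
    ((isProper_gibbsKernel {i}).lintegral_mul cylinderEvents_le_pi hf hprob x).symm
  have hkeep : Measurable fun x => acceptanceProb ε i x * f x := hprob'.mul hf
  have hrej : Measurable fun x => (1 - acceptanceProb ε i x) * f x := (hprob'.const_sub 1).mul hf
  simp only [lintegral_update_resampledSpin i _ hf, hkernel]
  rw [lintegral_add_right _ hrej,
    lintegral_lintegral_gibbsKernel hμ hkeep, ← lintegral_add_left hkeep]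
  simp only [← add_mul, add_tsub_cancel_of_le (acceptanceProb_le_one i _), one_mul]

end Resampling

/-! ### Simultaneous resampling of the active sites -/

section Sweep

variable {d : ℕ} {L ε : ℝ}

/-- The law of a fair coin. -/
def coinMeasure : Measure Bool := (PMF.uniformOfFintype Bool).toMeasure

instance isProbabilityMeasure_coinMeasure : IsProbabilityMeasure coinMeasure :=
  PMF.toMeasure.isProbabilityMeasure _

theorem coinMeasure_singleton (b : Bool) : coinMeasure {b} = 2⁻¹ := by
  rw [coinMeasure, PMF.toMeasure_apply_singleton _ _ (measurableSet_singleton b),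
    PMF.uniformOfFintype_apply, Fintype.card_bool, Nat.cast_ofNat]

/-- The randomness used at one site and one time: a coin, which decides about the activity of the
site, and a proposal. -/
abbrev Seed (L : ℝ) : Type := Bool × Proposal L

/-- The law of a seed: the coin is fair and independent of the proposal. -/
def seedMeasure (L : ℝ) : Measure (Seed L) := coinMeasure.prod (proposalMeasure L)

instance isProbabilityMeasure_seedMeasure [Fact (0 < L)] : IsProbabilityMeasure (seedMeasure L) :=
  inferInstanceAs (IsProbabilityMeasure (coinMeasure.prod (proposalMeasure L)))

/-- The coins of a family of seeds. -/
def coins (ω : Site d → Seed L) : Site d → Bool := fun i => (ω i).1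

theorem measurable_coins : Measurable (coins (d := d) (L := L)) := by
  unfold coins
  fun_prop

theorem coins_update (ω : Site d → Seed L) (i : Site d) (v : Proposal L) :
    coins (Function.update ω i ((ω i).1, v)) = coins ω := by
  ext1 j
  rcases eq_or_ne j i with rfl | hj
  · rw [coins, Function.update_self, coins]
  · rw [coins, Function.update_of_ne hj, coins]

/-- A site is active if its coin shows `true` and those of its neighbours show `false`, so that
no two neighbours are active together. -/
def IsActive (c : Site d → Bool) (i : Site d) : Prop :=
  c i = true ∧ ∀ j ∈ neighbours i, c j = false

theorem isActive_congr {c c' : Site d → Bool} {i : Site d}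
    (h : ∀ j ∈ insert i (neighbours i), c j = c' j) : IsActive c i ↔ IsActive c' i := by
  rw [Finset.forall_mem_insert] at h
  rw [IsActive, IsActive, h.1]
  exact and_congr_right fun _ => forall₂_congr fun j hj => by rw [h.2 j hj]

theorem measurableSet_isActive (i : Site d) : MeasurableSet {c : Site d → Bool | IsActive c i} := by
  unfold IsActive
  measurability

theorem resampledSpin_congr {i : Site d} {x y : Site d → Spin L} (v : Proposal L)
    (h : ∀ j ∈ insert i (neighbours i), x j = y j) :
    resampledSpin ε i v x = resampledSpin ε i v y := by
  rw [Finset.forall_mem_insert] at h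
  rw [resampledSpin, resampledSpin, h.1, acceptance_congr v.1 h.2]

/-- The simultaneous resampling of the spins at all active sites of `V`. -/
def sweep (ε : ℝ) (V : Set (Site d)) (ω : Site d → Seed L) (x : Site d → Spin L) :
    Site d → Spin L := fun i =>
  open Classical in
  if i ∈ V ∧ IsActive (coins ω) i then resampledSpin ε i (ω i).2 x else x i

theorem sweep_apply_congr {V V' : Set (Site d)} {ω ω' : Site d → Seed L} {x x' : Site d → Spin L}
    {i i' : Site d} (h : i ∈ V ∧ IsActive (coins ω) i ↔ i' ∈ V' ∧ IsActive (coins ω') i')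
    (hspin : resampledSpin ε i (ω i).2 x = resampledSpin ε i' (ω' i').2 x') (hx : x i = x' i') :
    sweep ε V ω x i = sweep ε V' ω' x' i' := by
  classical
  exact if_congr h hspin hx

theorem measurable_sweep (V : Set (Site d)) :
    Measurable fun p : (Site d → Seed L) × (Site d → Spin L) => sweep ε V p.1 p.2 := by
  refine measurable_pi_iff.2 fun i => Measurable.ite ?_ ?_ (by fun_prop)
  · exact (MeasurableSet.const _).inter
      ((measurable_coins.comp measurable_fst) (measurableSet_isActive i))
  · exact measurable_resampledSpin i (by fun_prop) measurable_snd

theorem sweep_empty (ω : Site d → Seed L) (x : Site d → Spin L) : sweep ε ∅ ω x = x :=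
  funext fun _ => if_neg fun h => h.1

theorem sweep_eq_self_of_isActive {V : Set (Site d)} {i j : Site d} {ω : Site d → Seed L}
    (hi : i ∉ V) (hact : IsActive (coins ω) i) (x : Site d → Spin L)
    (hj : j ∈ insert i (neighbours i)) : sweep ε V ω x j = x j := by
  refine if_neg fun h => ?_
  rcases Finset.mem_insert.1 hj with rfl | hj
  · exact hi h.1
  · exact Bool.false_ne_true ((hact.2 j hj).symm.trans h.2.1)

/-- The update of the spin at `i` by the proposal `v`, performed if the coins `c` make `i`
active. -/
def activeUpdate (ε : ℝ) (i : Site d) (c : Site d → Bool) (v : Proposal L)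
    (x : Site d → Spin L) : Site d → Spin L :=
  open Classical in
  if IsActive c i then Function.update x i (resampledSpin ε i v x) else x

theorem measurable_activeUpdate (i : Site d) :
    Measurable fun p : ((Site d → Bool) × (Site d → Spin L)) × Proposal L =>
      activeUpdate ε i p.1.1 p.2 p.1.2 := by
  refine Measurable.ite ((measurable_fst.comp measurable_fst) (measurableSet_isActive i)) ?_
    (by fun_prop)
  have hspin : Measurable fun p : ((Site d → Bool) × (Site d → Spin L)) × Proposal L =>
      resampledSpin ε i p.2 p.1.2 := measurable_resampledSpin i measurable_snd (by fun_prop)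
  exact measurable_update'.comp ((measurable_snd.comp measurable_fst).prodMk hspin)

theorem lintegral_lintegral_activeUpdate [Fact (0 < L)] {i : Site d}
    {μ : Measure (Site d → Spin L)} (hμ : gibbsKernel ε L {i} ∘ₘ μ = μ) (c : Site d → Bool)
    {f : (Site d → Spin L) → ℝ≥0∞} (hf : Measurable f) :
    ∫⁻ x, ∫⁻ v, f (activeUpdate ε i c v x) ∂proposalMeasure L ∂μ = ∫⁻ x, f x ∂μ := by
  by_cases hact : IsActive c i
  · simp only [activeUpdate, if_pos hact]
    exact lintegral_lintegral_update_resampledSpin hμ hf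
  · simp only [activeUpdate, if_neg hact, lintegral_const, measure_univ, mul_one]

-- The neighbours of an active site are not active: its update commutes with the others.
theorem sweep_insert {V : Set (Site d)} {i : Site d} (hi : i ∉ V) (ω : Site d → Seed L)
    (v : Proposal L) (x : Site d → Spin L) :
    sweep ε (insert i V) (Function.update ω i ((ω i).1, v)) x =
      activeUpdate ε i (coins ω) v (sweep ε V ω x) := by
  ext1 j
  rcases eq_or_ne j i with rfl | hj
  · rw [sweep, coins_update, Function.update_self]
    by_cases hact : IsActive (coins ω) j
    · rw [if_pos ⟨Set.mem_insert j V, hact⟩, activeUpdate, if_pos hact, Function.update_self]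
      exact resampledSpin_congr v fun k hk => (sweep_eq_self_of_isActive hi hact x hk).symm
    · rw [if_neg fun h => hact h.2, activeUpdate, if_neg hact, sweep, if_neg fun h => hi h.1]
  · have hoff : activeUpdate ε i (coins ω) v (sweep ε V ω x) j = sweep ε V ω x j := by
      rw [activeUpdate]
      split_ifs
      · exact Function.update_of_ne hj _ _
      · rfl
    rw [hoff]
    refine sweep_apply_congr ?_ (by rw [Function.update_of_ne hj]) rfl
    rw [coins_update, Set.mem_insert_iff, or_iff_right hj]

theorem lintegral_resample_proposal [Fact (0 < L)] (i : Site d)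
    {f : (Site d → Seed L) → ℝ≥0∞} (hf : Measurable f) :
    ∫⁻ ω, f ω ∂Measure.infinitePi (fun _ : Site d => seedMeasure L) =
      ∫⁻ ω, ∫⁻ v, f (Function.update ω i ((ω i).1, v)) ∂proposalMeasure L
        ∂Measure.infinitePi (fun _ : Site d => seedMeasure L) := by
  have hpair : Measurable fun p : (Site d → Seed L) × Proposal L =>
      (p.1, ((p.1 i).1, p.2)) := by fun_prop
  have hm : Measurable fun p : (Site d → Seed L) × Proposal L =>
      f (Function.update p.1 i ((p.1 i).1, p.2)) := hf.comp (measurable_update'.comp hpair)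
  rw [lintegral_infinitePi_eq_lintegral_update _ i hf,
    lintegral_infinitePi_eq_lintegral_update _ i hm.lintegral_prod_right']
  refine lintegral_congr fun ω => ?_
  have hmω : Measurable fun w : Seed L => f (Function.update ω i w) :=
    hf.comp (measurable_update ω)
  have hmω' : Measurable fun w : Seed L =>
      ∫⁻ v, f (Function.update ω i (w.1, v)) ∂proposalMeasure L :=
    Measurable.lintegral_prod_right' (f := fun p : Seed L × Proposal L =>
      f (Function.update ω i (p.1.1, p.2))) (hmω.comp (by fun_prop))
  simp only [Function.update_self, Function.update_idem]
  rw [seedMeasure, lintegral_prod _ hmω.aemeasurable, lintegral_prod _ hmω'.aemeasurable]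
  simp only [lintegral_const, measure_univ, mul_one]

theorem lintegral_sweep [Fact (0 < L)] {μ : Measure (Site d → Spin L)} [SFinite μ]
    (V : Finset (Site d)) (hμ : ∀ i ∈ V, gibbsKernel ε L {i} ∘ₘ μ = μ)
    {f : (Site d → Bool) × (Site d → Spin L) → ℝ≥0∞} (hf : Measurable f) :
    ∫⁻ ω, ∫⁻ x, f (coins ω, sweep ε V ω x) ∂μ
        ∂Measure.infinitePi (fun _ : Site d => seedMeasure L) =
      ∫⁻ ω, ∫⁻ x, f (coins ω, x) ∂μ ∂Measure.infinitePi (fun _ : Site d => seedMeasure L) := by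
  induction V using Finset.induction_on generalizing f with
  | empty => simp only [Finset.coe_empty, sweep_empty]
  | insert i V hi ih =>
    have hmsweep : Measurable fun p : (Site d → Seed L) × (Site d → Spin L) =>
        f (coins p.1, sweep ε (insert i V : Finset (Site d)) p.1 p.2) :=
      hf.comp ((measurable_coins.comp measurable_fst).prodMk (measurable_sweep _))
    have hmupdate : Measurable fun q : ((Site d → Bool) × (Site d → Spin L)) × Proposal L =>
        f (q.1.1, activeUpdate ε i q.1.1 q.2 q.1.2) :=
      hf.comp ((measurable_fst.comp measurable_fst).prodMk (measurable_activeUpdate i))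
    rw [lintegral_resample_proposal i hmsweep.lintegral_prod_right']
    simp only [coins_update, Finset.coe_insert, sweep_insert (Finset.mem_coe.not.2 hi)]
    have hswap (ω : Site d → Seed L) :
        ∫⁻ v, ∫⁻ x, f (coins ω, activeUpdate ε i (coins ω) v (sweep ε V ω x)) ∂μ
            ∂proposalMeasure L =
          ∫⁻ x, ∫⁻ v, f (coins ω, activeUpdate ε i (coins ω) v (sweep ε V ω x))
            ∂proposalMeasure L ∂μ := by
      have hms : Measurable fun p : Proposal L × (Site d → Spin L) => sweep ε V ω p.2 :=
        (measurable_sweep (V : Set (Site d))).comp (measurable_const.prodMk measurable_snd)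
      exact lintegral_lintegral_swap
        (hmupdate.comp ((measurable_const.prodMk hms).prodMk measurable_fst)).aemeasurable
    simp only [hswap]
    rw [ih (fun j hj => hμ j (Finset.mem_insert_of_mem hj)) hmupdate.lintegral_prod_right']
    exact lintegral_congr fun ω => lintegral_lintegral_activeUpdate
      (hμ i (Finset.mem_insert_self _ _)) (coins ω) (hf.comp measurable_prodMk_left)

end Sweep

/-! ### Coupling from the past -/

section CouplingFromThePast

variable {d : ℕ} {L ε : ℝ}

/-- The configuration at time `0` of the dynamics in `V` started at time `-n`; the slice `n` of
the seeds is used at time `-n`, so that the last sweep uses the head slice. -/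
def run (ε : ℝ) (V : Set (Site d)) :
    ℕ → (Site d → ℕ → Seed L) → (Site d → Spin L) → (Site d → Spin L)
  | 0, _, x => x
  | n + 1, y, x => sweep ε V (headSlice y) (run ε V n (tailSlices y) x)

/-- A proposal whose uniform variable is at most this threshold is accepted whatever the
neighbouring spins. -/
def sureAcceptance (ε L : ℝ) : ℝ := Real.exp (-(2 * (|ε| * L ^ 2)))

/-- The exploration of the past started from the site `i` survives for `n` steps. If it does not,
then the spin at `i` and time `0` does not depend on the configuration at time `-n`. -/
def Alive (ε : ℝ) : ℕ → (Site d → ℕ → Seed L) → Site d → Prop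
  | 0, _, _ => True
  | n + 1, y, i => (¬ IsActive (coins (headSlice y)) i ∧ Alive ε n (tailSlices y) i) ∨
      (sureAcceptance ε L < (headSlice y i).2.2.1 ∧
        ∃ j ∈ insert i (neighbours i), Alive ε n (tailSlices y) j)

theorem sureAcceptance_mem_unitInterval (ε L : ℝ) : sureAcceptance ε L ∈ unitInterval := by
  refine ⟨(Real.exp_pos _).le, Real.exp_le_one_iff.2 (neg_nonpos.2 ?_)⟩
  positivity

theorem sureAcceptance_le_acceptance (i : Site d) (x : Site d → Spin L) (z : Spin L) :
    sureAcceptance ε L ≤ acceptance ε i x z := by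
  rw [sureAcceptance, acceptance, Real.exp_le_exp]
  linarith [neg_abs_le (localField ε i x * z.1), abs_localField_mul_le (ε := ε) i x z]

theorem resampledSpin_of_le_sureAcceptance {v : Proposal L} (h : v.2.1 ≤ sureAcceptance ε L)
    (i : Site d) (x : Site d → Spin L) : resampledSpin ε i v x = v.1 :=
  if_pos (h.trans (sureAcceptance_le_acceptance i x v.1))

theorem run_eq_of_not_alive {V : Set (Site d)} {n : ℕ} {y : Site d → ℕ → Seed L} {i : Site d}
    (h : ¬ Alive ε n y i) (hV : ∀ j, latticeDist j i ≤ n → j ∈ V) (x x' : Site d → Spin L) :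
    run ε V n y x i = run ε Set.univ n y x' i := by
  induction n generalizing y i with
  | zero => exact absurd trivial h
  | succ n ih =>
    simp only [Alive, not_or, not_and, not_exists] at h
    have hi : i ∈ V := hV i ((latticeDist_self i).trans_le (Nat.zero_le _))
    have hrun {j : Site d} (hj : j ∈ insert i (neighbours i))
        (hdead : ¬ Alive ε n (tailSlices y) j) :
        run ε V n (tailSlices y) x j = run ε Set.univ n (tailSlices y) x' j :=
      ih hdead fun l hl => hV l (latticeDist_le_succ_of_mem hj hl)
    rw [run, run, sweep, sweep]
    by_cases hact : IsActive (coins (headSlice y)) i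
    · rw [if_pos ⟨hi, hact⟩, if_pos ⟨Set.mem_univ i, hact⟩]
      rcases le_or_gt (headSlice y i).2.2.1 (sureAcceptance ε L) with hu | hu
      · rw [resampledSpin_of_le_sureAcceptance hu, resampledSpin_of_le_sureAcceptance hu]
      · exact resampledSpin_congr _ fun j hj => hrun hj (h.2 hu j hj)
    · rw [if_neg fun hV => hact hV.2, if_neg fun hV => hact hV.2]
      exact hrun (Finset.mem_insert_self _ _) (h.1 hact)

theorem exists_run_add_eq (V : Set (Site d)) (m k : ℕ) (y : Site d → ℕ → Seed L)
    (x : Site d → Spin L) : ∃ x', run ε V (m + k) y x = run ε V m y x' := by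
  induction m generalizing y with
  | zero => exact ⟨run ε V k y x, by rw [Nat.zero_add, run]⟩
  | succ m ih =>
    obtain ⟨x', hx'⟩ := ih (tailSlices y)
    exact ⟨x', by rw [Nat.succ_add, run, hx', run]⟩

theorem sweep_congr {V : Set (Site d)} {ω ω' : Site d → Seed L} {x x' : Site d → Spin L}
    {i : Site d} (hω : ∀ j ∈ insert i (neighbours i), ω' j = ω j)
    (hx : ∀ j ∈ insert i (neighbours i), x' j = x j) : sweep ε V ω' x' i = sweep ε V ω x i := by
  have hact : IsActive (coins ω') i ↔ IsActive (coins ω) i :=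
    isActive_congr fun j hj => by rw [coins, hω j hj, coins]
  have hi := Finset.mem_insert_self i (neighbours i)
  exact sweep_apply_congr (and_congr_right' hact)
    (by rw [hω i hi, resampledSpin_congr _ hx]) (hx i hi)

theorem tailSlices_congr {y y' : Site d → ℕ → Seed L} {j : Site d} (h : y' j = y j) :
    tailSlices y' j = tailSlices y j := by
  ext1 t
  rw [tailSlices, h, tailSlices]

theorem alive_congr {n : ℕ} {y y' : Site d → ℕ → Seed L} {i : Site d}
    (h : ∀ j, latticeDist j i ≤ n → y' j = y j) : Alive ε n y' i ↔ Alive ε n y i := by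
  induction n generalizing y y' i with
  | zero => rfl
  | succ n ih =>
    have hhead (j : Site d) (hj : j ∈ insert i (neighbours i)) :
        headSlice y' j = headSlice y j := by
      rw [headSlice, h j (latticeDist_le_succ_of_mem hj (by simp [latticeDist_self])), headSlice]
    have htail (j : Site d) (hj : j ∈ insert i (neighbours i)) :
        Alive ε n (tailSlices y') j ↔ Alive ε n (tailSlices y) j :=
      ih fun l hl => tailSlices_congr (h l (latticeDist_le_succ_of_mem hj hl))
    have hi := Finset.mem_insert_self i (neighbours i)
    have hact : IsActive (coins (headSlice y')) i ↔ IsActive (coins (headSlice y)) i :=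
      isActive_congr fun j hj => by rw [coins, hhead j hj, coins]
    rw [Alive, Alive, hact, htail i hi, hhead i hi]
    exact or_congr_right (and_congr_right' (exists_congr fun j => and_congr_right (htail j)))

theorem run_congr {V : Set (Site d)} {n : ℕ} {y y' : Site d → ℕ → Seed L} {i : Site d}
    (x : Site d → Spin L) (h : ∀ j, latticeDist j i ≤ n → y' j = y j) :
    run ε V n y' x i = run ε V n y x i := by
  induction n generalizing y y' i with
  | zero => rfl
  | succ n ih =>
    refine sweep_congr (fun j hj => ?_) fun j hj => ih fun l hl =>
      tailSlices_congr (h l (latticeDist_le_succ_of_mem hj hl))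
    rw [headSlice, h j (latticeDist_le_succ_of_mem hj (by simp [latticeDist_self])), headSlice]

theorem isActive_shiftConfig (k i : Site d) (c : Site d → Bool) :
    IsActive (shiftConfig k c) i ↔ IsActive c (k + i) := by
  simp only [IsActive, shiftConfig, neighbours_add, Finset.forall_mem_image]

theorem localField_shiftConfig (k i : Site d) (x : Site d → Spin L) :
    localField ε i (shiftConfig k x) = localField ε (k + i) x := by
  simp only [localField, shiftConfig, add_assoc, add_sub_assoc]

theorem resampledSpin_shiftConfig (k i : Site d) (v : Proposal L) (x : Site d → Spin L) :
    resampledSpin ε i v (shiftConfig k x) = resampledSpin ε (k + i) v x := by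
  rw [resampledSpin, acceptance, localField_shiftConfig]
  rfl

theorem sweep_shiftConfig (k : Site d) (ω : Site d → Seed L) (x : Site d → Spin L) :
    sweep ε Set.univ (shiftConfig k ω) (shiftConfig k x) =
      shiftConfig k (sweep ε Set.univ ω x) := by
  have hcoins : coins (shiftConfig k ω) = shiftConfig k (coins ω) := rfl
  ext1 i
  refine sweep_apply_congr ?_ (resampledSpin_shiftConfig k i _ x) rfl
  rw [hcoins, isActive_shiftConfig, iff_true_intro (Set.mem_univ i),
    iff_true_intro (Set.mem_univ (k + i))]

theorem run_shiftConfig (k : Site d) (n : ℕ) (y : Site d → ℕ → Seed L) (x : Site d → Spin L) :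
    run ε Set.univ n (shiftConfig k y) (shiftConfig k x) =
      shiftConfig k (run ε Set.univ n y x) := by
  induction n generalizing y with
  | zero => rfl
  | succ n ih => exact (congrArg _ (ih (tailSlices y))).trans (sweep_shiftConfig k (headSlice y) _)

theorem alive_shiftConfig (k i : Site d) (n : ℕ) (y : Site d → ℕ → Seed L) :
    Alive ε n (shiftConfig k y) i ↔ Alive ε n y (k + i) := by
  induction n generalizing y i with
  | zero => rfl
  | succ n ih =>
    have htail : tailSlices (shiftConfig k y) = shiftConfig k (tailSlices y) := rfl
    have hcoins : coins (headSlice (shiftConfig k y)) = shiftConfig k (coins (headSlice y)) := rfl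
    have hhead (i : Site d) : headSlice (shiftConfig k y) i = headSlice y (k + i) := rfl
    simp only [Alive, htail, ih, hcoins, isActive_shiftConfig, hhead, neighbours_add,
      Finset.mem_insert, Finset.mem_image, exists_eq_or_imp, exists_exists_and_eq_and]

theorem measurable_run (V : Set (Site d)) (n : ℕ) :
    Measurable fun p : (Site d → ℕ → Seed L) × (Site d → Spin L) => run ε V n p.1 p.2 := by
  induction n with
  | zero => exact measurable_snd
  | succ n ih =>
    have htail : Measurable fun p : (Site d → ℕ → Seed L) × (Site d → Spin L) =>
        (tailSlices p.1, p.2) := (measurable_tailSlices.comp measurable_fst).prodMk measurable_snd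
    exact (measurable_sweep V).comp
      ((measurable_headSlice.comp measurable_fst).prodMk (ih.comp htail))

theorem measurableSet_sureAcceptance_lt (i : Site d) :
    MeasurableSet {ω : Site d → Seed L | sureAcceptance ε L < (ω i).2.2.1} :=
  measurableSet_lt measurable_const (by fun_prop)

theorem setOf_alive_succ (n : ℕ) (i : Site d) :
    {y : Site d → ℕ → Seed L | Alive ε (n + 1) y i} = (fun y => (headSlice y, tailSlices y)) ⁻¹'
      ({ω | IsActive (coins ω) i}ᶜ ×ˢ {y | Alive ε n y i} ∪
        ⋃ j ∈ insert i (neighbours i),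
          {ω | sureAcceptance ε L < (ω i).2.2.1} ×ˢ {y | Alive ε n y j}) := by
  ext y
  simp [Alive, and_or_left]

theorem measurableSet_alive (n : ℕ) (i : Site d) :
    MeasurableSet {y : Site d → ℕ → Seed L | Alive ε n y i} := by
  induction n generalizing i with
  | zero => exact MeasurableSet.univ
  | succ n ih =>
    rw [setOf_alive_succ]
    refine (measurable_headSlice.prodMk measurable_tailSlices) (.union ?_ ?_)
    · exact (measurable_coins (measurableSet_isActive i)).compl.prod (ih i)
    · exact Finset.measurableSet_biUnion _ fun j _ =>
        (measurableSet_sureAcceptance_lt i).prod (ih j)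

theorem exists_not_alive_or_forall_alive (ε : ℝ) (y : Site d → ℕ → Seed L) (i : Site d) :
    ∃ n, ¬ Alive ε n y i ∨ ∀ m, Alive ε m y i := by
  by_cases h : ∃ n, ¬ Alive ε n y i
  · exact h.imp fun _ => .inl
  · exact ⟨0, .inr (not_exists_not.1 h)⟩

/-- The dynamics in the whole lattice started in the infinite past: at a site where the
exploration of the past dies out, the dynamics is started before that time. At the other sites,
which almost surely do not occur, the value is `s`. -/
def pastCoding (ε : ℝ) (s : Spin L) (y : Site d → ℕ → Seed L) : Site d → Spin L := fun i =>
  open Classical in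
  run ε Set.univ (Nat.find (exists_not_alive_or_forall_alive ε y i)) y (fun _ => s) i

variable {s : Spin L}

theorem pastCoding_eq_run {n : ℕ} {y : Site d → ℕ → Seed L} {i : Site d}
    (h : ¬ Alive ε n y i) (x : Site d → Spin L) :
    pastCoding ε s y i = run ε Set.univ n y x i := by
  classical
  have hex := exists_not_alive_or_forall_alive ε y i
  obtain ⟨k, hk⟩ := Nat.exists_eq_add_of_le (Nat.find_min' hex (.inl h))
  have hdead : ¬ Alive ε (Nat.find hex) y i := (Nat.find_spec hex).resolve_right fun h' => h (h' n)
  obtain ⟨x', hx'⟩ := exists_run_add_eq (ε := ε) Set.univ (Nat.find hex) k y x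
  rw [pastCoding, hk, hx']
  exact run_eq_of_not_alive hdead (fun _ _ => Set.mem_univ _) _ _

theorem pastCoding_eq_of_forall_alive {y : Site d → ℕ → Seed L} {i : Site d}
    (h : ∀ n, Alive ε n y i) : pastCoding ε s y i = s := by
  classical
  rw [pastCoding, (Nat.find_eq_zero (exists_not_alive_or_forall_alive ε y i)).2 (.inr h), run]

theorem pastCoding_shiftConfig (k : Site d) (y : Site d → ℕ → Seed L) :
    pastCoding ε s (shiftConfig k y) = shiftConfig k (pastCoding ε s y) := by
  ext1 i
  change _ = pastCoding ε s y (k + i)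
  by_cases h : ∃ n, ¬ Alive ε n y (k + i)
  · obtain ⟨n, hn⟩ := h
    rw [pastCoding_eq_run hn fun _ => s,
      pastCoding_eq_run (mt (alive_shiftConfig k i n y).1 hn) (shiftConfig k fun _ => s),
      run_shiftConfig, shiftConfig]
  · have hall := not_exists_not.1 h
    rw [pastCoding_eq_of_forall_alive hall,
      pastCoding_eq_of_forall_alive fun n => (alive_shiftConfig k i n y).2 (hall n)]

theorem measurable_pastCoding : Measurable (pastCoding (d := d) ε s) := by
  classical
  refine measurable_pi_iff.2 fun i => Measurable.find
    (f := fun n y => run ε Set.univ n y (fun _ => s) i)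
    (p := fun n (y : Site d → ℕ → Seed L) => ¬ Alive ε n y i ∨ ∀ m, Alive ε m y i)
    (fun n => ?_) (fun n => ?_) fun y => exists_not_alive_or_forall_alive ε y i
  · exact (measurable_pi_apply i).comp ((measurable_run Set.univ n).comp measurable_prodMk_right)
  · have hall : MeasurableSet {y : Site d → ℕ → Seed L | ∀ m, Alive ε m y i} := by
      rw [Set.ofPred_forall]
      exact .iInter fun m => measurableSet_alive m i
    exact (measurableSet_alive n i).compl.union hall

theorem codingRadius_pastCoding_le {n : ℕ} {y : Site d → ℕ → Seed L} {i : Site d}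
    (h : ¬ Alive ε n y i) : codingRadius (pastCoding ε s) i y ≤ n := by
  refine iInf₂_le n fun y' hy' => ?_
  rw [pastCoding_eq_run h fun _ => s, pastCoding_eq_run (mt (alive_congr hy').1 h) fun _ => s,
    run_congr _ hy']

end CouplingFromThePast

/-! ### The exploration of the past dies out -/

section Survival

variable {d : ℕ} {L ε : ℝ}

/-- A bound for the mean number of offspring of a site in the exploration of the past: a site that
is not active has one, an active one with a proposal that may be rejected has at most
`2 * d + 1`. -/
def survivalRate (d : ℕ) (L ε : ℝ) : ℝ≥0∞ :=
  (1 - 2⁻¹ ^ (2 * d + 1)) + (2 * d + 1 : ℕ) * ENNReal.ofReal (1 - sureAcceptance ε L)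

theorem setOf_isActive (i : Site d) :
    {ω : Site d → Seed L | IsActive (coins ω) i} =
      ((insert i (neighbours i) : Finset (Site d)) : Set (Site d)).pi fun j =>
        {decide (j = i)} ×ˢ Set.univ := by
  ext ω
  have hne : ∀ j ∈ neighbours i, j ≠ i := fun j hj h => self_notMem_neighbours i (h ▸ hj)
  simp only [IsActive, coins, Set.mem_ofPred_eq, Set.mem_pi, Finset.mem_coe, Set.mem_prod,
    Set.mem_singleton_iff, Set.mem_univ, and_true, Finset.forall_mem_insert, decide_true]
  refine and_congr_right fun _ => forall₂_congr fun j hj => ?_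
  rw [decide_eq_false (hne j hj)]

variable [Fact (0 < L)]

theorem le_measure_isActive (i : Site d) :
    2⁻¹ ^ (2 * d + 1) ≤
      Measure.infinitePi (fun _ : Site d => seedMeasure L) {ω | IsActive (coins ω) i} := by
  have hval (j : Site d) : seedMeasure L ({decide (j = i)} ×ˢ Set.univ) = 2⁻¹ := by
    rw [seedMeasure, Measure.prod_prod, coinMeasure_singleton, measure_univ, mul_one]
  rw [setOf_isActive,
    Measure.infinitePi_pi _ fun j _ => (measurableSet_singleton _).prod MeasurableSet.univ]
  simp only [hval, Finset.prod_const]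
  exact pow_le_pow_right_of_le_one' (by simp) (card_insert_neighbours_le i)

theorem measure_sureAcceptance_lt (ε : ℝ) (i : Site d) :
    Measure.infinitePi (fun _ : Site d => seedMeasure L)
      {ω | sureAcceptance ε L < (ω i).2.2.1} = ENNReal.ofReal (1 - sureAcceptance ε L) := by
  have hm : MeasurableSet {w : Seed L | sureAcceptance ε L < w.2.2.1} :=
    measurableSet_lt measurable_const (by fun_prop)
  have hprod : {w : Seed L | sureAcceptance ε L < w.2.2.1} = Set.univ ×ˢ (Set.univ ×ˢ
      Set.Ioi (⟨sureAcceptance ε L, sureAcceptance_mem_unitInterval ε L⟩ : unitInterval)) := by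
    ext w
    simp [← Subtype.coe_lt_coe]
  have heval := measurePreserving_eval_infinitePi (fun _ : Site d => seedMeasure L) i
  refine (heval.measure_preimage hm.nullMeasurableSet).trans ?_
  rw [hprod, seedMeasure, Measure.prod_prod, proposalMeasure, Measure.prod_prod, measure_univ,
    measure_univ, one_mul, one_mul, unitInterval.volume_Ioi]

theorem measure_alive_succ_le (ε : ℝ) (n : ℕ) (i : Site d) :
    spaceTimeMeasure (Site d) (seedMeasure L) {y | Alive ε (n + 1) y i} ≤
      (1 - 2⁻¹ ^ (2 * d + 1)) *
          spaceTimeMeasure (Site d) (seedMeasure L) {y | Alive ε n y i} +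
        ∑ j ∈ insert i (neighbours i), ENNReal.ofReal (1 - sureAcceptance ε L) *
          spaceTimeMeasure (Site d) (seedMeasure L) {y | Alive ε n y j} := by
  have hact : MeasurableSet {ω : Site d → Seed L | IsActive (coins ω) i} :=
    measurable_coins (measurableSet_isActive i)
  have hmeas := (hact.compl.prod (measurableSet_alive (L := L) (ε := ε) n i)).union
    (Finset.measurableSet_biUnion (insert i (neighbours i)) fun j _ =>
      (measurableSet_sureAcceptance_lt (L := L) (ε := ε) i).prod
        (measurableSet_alive (L := L) (ε := ε) n j))
  rw [setOf_alive_succ, (measurePreserving_headSlice_tailSlices (Site d)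
    (seedMeasure L)).measure_preimage hmeas.nullMeasurableSet]
  refine (measure_union_le _ _).trans (add_le_add ?_ ?_)
  · rw [Measure.prod_prod, prob_compl_eq_one_sub hact]
    gcongr
    exact le_measure_isActive i
  · refine (measure_biUnion_finset_le _ _).trans (Finset.sum_le_sum fun j _ => ?_)
    rw [Measure.prod_prod, measure_sureAcceptance_lt]

theorem measure_alive_le (ε : ℝ) (n : ℕ) (i : Site d) :
    spaceTimeMeasure (Site d) (seedMeasure L) {y | Alive ε n y i} ≤ survivalRate d L ε ^ n := by
  induction n generalizing i with
  | zero =>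
    rw [pow_zero]
    exact prob_le_one
  | succ n ih =>
    calc spaceTimeMeasure (Site d) (seedMeasure L) {y | Alive ε (n + 1) y i}
        ≤ (1 - 2⁻¹ ^ (2 * d + 1)) * survivalRate d L ε ^ n +
            ∑ _j ∈ insert i (neighbours i),
              ENNReal.ofReal (1 - sureAcceptance ε L) * survivalRate d L ε ^ n := by
          refine (measure_alive_succ_le ε n i).trans ?_
          gcongr <;> exact ih _
      _ = ((1 - 2⁻¹ ^ (2 * d + 1)) + (insert i (neighbours i)).card *
            ENNReal.ofReal (1 - sureAcceptance ε L)) * survivalRate d L ε ^ n := by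
          rw [Finset.sum_const, nsmul_eq_mul, ← mul_assoc, ← add_mul]
      _ ≤ survivalRate d L ε * survivalRate d L ε ^ n := by
          rw [survivalRate]
          gcongr
          exact card_insert_neighbours_le i
      _ = survivalRate d L ε ^ (n + 1) := (pow_succ' _ n).symm

theorem measure_biUnion_alive_le (ε : ℝ) (n : ℕ) (Δ : Finset (Site d)) :
    spaceTimeMeasure (Site d) (seedMeasure L) (⋃ i ∈ Δ, {y | Alive ε n y i}) ≤
      Δ.card * survivalRate d L ε ^ n := by
  refine (measure_biUnion_finset_le _ _).trans ?_
  refine (Finset.sum_le_sum fun i _ => measure_alive_le ε n i).trans_eq ?_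
  rw [Finset.sum_const, nsmul_eq_mul]

end Survival

theorem survivalRate_lt_one {d : ℕ} {L ε : ℝ} (hL : L ≠ 0)
    (h : |ε| < (1 / 2) ^ (2 * d + 1) / ((2 * d + 1) * (2 * L ^ 2))) :
    survivalRate d L ε < 1 := by
  have hsure : 1 - sureAcceptance ε L ≤ 2 * (|ε| * L ^ 2) := by
    rw [sureAcceptance]
    linarith [Real.add_one_le_exp (-(2 * (|ε| * L ^ 2)))]
  have hreal : ((2 * d + 1 : ℕ) : ℝ) * (1 - sureAcceptance ε L) < (1 / 2) ^ (2 * d + 1) := by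
    rw [lt_div_iff₀ (by positivity)] at h
    push_cast
    calc (2 * d + 1 : ℝ) * (1 - sureAcceptance ε L)
        ≤ (2 * d + 1 : ℝ) * (2 * (|ε| * L ^ 2)) := by gcongr
      _ = |ε| * ((2 * d + 1) * (2 * L ^ 2)) := by ring
      _ < (1 / 2) ^ (2 * d + 1) := h
  have hhalf : (2⁻¹ : ℝ≥0∞) ^ (2 * d + 1) = ENNReal.ofReal ((1 / 2) ^ (2 * d + 1)) := by
    rw [ENNReal.ofReal_pow (by norm_num), one_div, ENNReal.ofReal_inv_of_pos two_pos,
      ENNReal.ofReal_ofNat]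
  have hoffspring : ((2 * d + 1 : ℕ) : ℝ≥0∞) * ENNReal.ofReal (1 - sureAcceptance ε L) <
      2⁻¹ ^ (2 * d + 1) := by
    rw [hhalf, ← ENNReal.ofReal_natCast, ← ENNReal.ofReal_mul (Nat.cast_nonneg _)]
    exact (ENNReal.ofReal_lt_ofReal_iff (by positivity)).2 hreal
  calc survivalRate d L ε < (1 - 2⁻¹ ^ (2 * d + 1)) + 2⁻¹ ^ (2 * d + 1) :=
        ENNReal.add_lt_add_left (ne_top_of_le_ne_top ENNReal.one_ne_top tsub_le_self) hoffspring
    _ = 1 := tsub_add_cancel_of_le (pow_le_one' (by simp) _)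

/-! ### The law of the coding is the Gibbs measure -/

section PastLaw

variable {d : ℕ} {L ε : ℝ} [Fact (0 < L)]

theorem lintegral_run {μ : Measure (Site d → Spin L)} [SFinite μ] (V : Finset (Site d))
    (hμ : ∀ i ∈ V, gibbsKernel ε L {i} ∘ₘ μ = μ) (n : ℕ)
    {f : (Site d → Spin L) → ℝ≥0∞} (hf : Measurable f) :
    ∫⁻ y, ∫⁻ x, f (run ε V n y x) ∂μ ∂spaceTimeMeasure (Site d) (seedMeasure L) =
      ∫⁻ x, f x ∂μ := by
  induction n generalizing f with
  | zero => simp only [run, lintegral_const, measure_univ, mul_one]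
  | succ n ih =>
    have hsweep := measurable_sweep (L := L) (ε := ε) (V : Set (Site d))
    have hrun : Measurable fun q : ((Site d → Seed L) × (Site d → ℕ → Seed L)) ×
        (Site d → Spin L) => run ε V n q.1.2 q.2 :=
      (measurable_run (V : Set (Site d)) n).comp
        ((measurable_snd.comp measurable_fst).prodMk measurable_snd)
    have hslices : Measurable fun q : (Site d → Seed L) × (Site d → ℕ → Seed L) =>
        ∫⁻ x, f (sweep ε V q.1 (run ε V n q.2 x)) ∂μ :=
      (hf.comp (hsweep.comp ((measurable_fst.comp measurable_fst).prodMk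
        hrun))).lintegral_prod_right'
    calc ∫⁻ y, ∫⁻ x, f (run ε V (n + 1) y x) ∂μ ∂spaceTimeMeasure (Site d) (seedMeasure L)
        = ∫⁻ ω, ∫⁻ y, ∫⁻ x, f (sweep ε V ω (run ε V n y x)) ∂μ
            ∂spaceTimeMeasure (Site d) (seedMeasure L)
            ∂Measure.infinitePi fun _ : Site d => seedMeasure L :=
          ((measurePreserving_headSlice_tailSlices (Site d) (seedMeasure L)).lintegral_comp
            hslices).trans (lintegral_prod _ hslices.aemeasurable)
      _ = ∫⁻ ω, ∫⁻ x, f (sweep ε V ω x) ∂μ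
            ∂Measure.infinitePi fun _ : Site d => seedMeasure L :=
          lintegral_congr fun ω => ih (hf.comp (hsweep.comp measurable_prodMk_left))
      _ = ∫⁻ x, f x ∂μ :=
          (lintegral_sweep V hμ (f := fun q => f q.2) (hf.comp measurable_snd)).trans
            (by simp only [lintegral_const, measure_univ, mul_one])

/-- The law of the configuration that the dynamics started in the infinite past has reached at
time `0`. -/
def pastLaw (d : ℕ) (L ε : ℝ) (s : Spin L) : Measure (Site d → Spin L) :=
  (spaceTimeMeasure (Site d) (seedMeasure L)).map (pastCoding ε s)

instance isProbabilityMeasure_pastLaw (s : Spin L) : IsProbabilityMeasure (pastLaw d L ε s) :=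
  Measure.isProbabilityMeasure_map measurable_pastCoding.aemeasurable

variable {Δ : Finset (Site d)} {f : (Site d → Spin L) → ℝ≥0∞}

theorem lintegral_pastLaw_mem_Icc {μ : Measure (Site d → Spin L)} [IsProbabilityMeasure μ] {n : ℕ}
    (hμ : ∀ i ∈ thickening Δ n, gibbsKernel ε L {i} ∘ₘ μ = μ) (hf : Measurable f)
    (hf₁ : ∀ x, f x ≤ 1) (hfΔ : DependsOn f (Δ : Set (Site d))) (s : Spin L) :
    ∫⁻ x, f x ∂μ ∈ Set.Icc (∫⁻ x, f x ∂pastLaw d L ε s - Δ.card * survivalRate d L ε ^ n)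
      (∫⁻ x, f x ∂pastLaw d L ε s + Δ.card * survivalRate d L ε ^ n) := by
  have hE : MeasurableSet (⋃ i ∈ Δ, {y : Site d → ℕ → Seed L | Alive ε n y i}) :=
    Finset.measurableSet_biUnion _ fun i _ => measurableSet_alive n i
  have hcoupled : ∀ y ∉ ⋃ i ∈ Δ, {y : Site d → ℕ → Seed L | Alive ε n y i},
      ∫⁻ x, f (run ε (thickening Δ n) n y x) ∂μ = f (pastCoding ε s y) := by
    intro y hy
    simp only [Set.mem_iUnion, not_exists] at hy
    have hdead (x : Site d → Spin L) : f (run ε (thickening Δ n) n y x) = f (pastCoding ε s y) :=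
      hfΔ fun i hi => (run_eq_of_not_alive (hy i hi) (fun j hj => mem_thickening.2 ⟨i, hi, hj⟩)
        x x).trans (pastCoding_eq_run (hy i hi) x).symm
    simp only [hdead, lintegral_const, measure_univ, mul_one]
  have hrun₁ (y : Site d → ℕ → Seed L) : ∫⁻ x, f (run ε (thickening Δ n) n y x) ∂μ ≤ 1 :=
    (lintegral_mono fun x => hf₁ _).trans_eq (by rw [lintegral_const, measure_univ, mul_one])
  rw [pastLaw, lintegral_map hf measurable_pastCoding, ← lintegral_run _ hμ n hf]
  refine ⟨tsub_le_iff_right.2 ?_, ?_⟩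
  · refine (lintegral_le_add_measure hE (fun y => hf₁ _) fun y hy => (hcoupled y hy).ge).trans ?_
    gcongr
    exact measure_biUnion_alive_le ε n Δ
  · refine (lintegral_le_add_measure hE hrun₁ fun y hy => (hcoupled y hy).le).trans ?_
    gcongr
    exact measure_biUnion_alive_le ε n Δ

theorem tendsto_lintegral_pastLaw (hr : survivalRate d L ε < 1)
    {μ : ℕ → Measure (Site d → Spin L)} [∀ n, IsProbabilityMeasure (μ n)]
    (hμ : ∀ n, ∀ i ∈ thickening Δ n, gibbsKernel ε L {i} ∘ₘ μ n = μ n) (hf : Measurable f)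
    (hf₁ : ∀ x, f x ≤ 1) (hfΔ : DependsOn f (Δ : Set (Site d))) (s : Spin L) :
    Filter.Tendsto (fun n => ∫⁻ x, f x ∂μ n) Filter.atTop (nhds (∫⁻ x, f x ∂pastLaw d L ε s)) := by
  have hrate : Filter.Tendsto (fun n : ℕ => (Δ.card : ℝ≥0∞) * survivalRate d L ε ^ n)
      Filter.atTop (nhds 0) := by
    simpa only [mul_zero] using ENNReal.Tendsto.const_mul
      (ENNReal.tendsto_pow_atTop_nhds_zero_of_lt_one hr) (.inr (ENNReal.natCast_ne_top Δ.card))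
  refine (ENNReal.tendsto_nhds ?_).2 fun δ hδ => ?_
  · exact ne_top_of_le_ne_top ENNReal.one_ne_top
      ((lintegral_mono hf₁).trans_eq (by rw [lintegral_const, measure_univ, mul_one]))
  · filter_upwards [hrate.eventually (ge_mem_nhds hδ)] with n hn
    exact Set.Icc_subset_Icc (tsub_le_tsub_left hn _) (add_le_add_right hn _)
      (lintegral_pastLaw_mem_Icc (hμ n) hf hf₁ hfΔ s)

theorem isTruncatedGibbs_pastLaw (hr : survivalRate d L ε < 1) (s : Spin L) :
    IsTruncatedGibbs ε L (pastLaw d L ε s) := by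
  refine isTruncatedGibbs_iff_forall_gibbsKernel_comp_eq.2 fun Λ => ?_
  refine (measure_ext_of_dependsOn fun Δ f hf hf₁ hfΔ => ?_).symm
  let Δ' : Finset (Site d) := Δ ∪ thickening Λ 1
  let g : (Site d → Spin L) → ℝ≥0∞ := fun ξ => ∫⁻ x, f x ∂gibbsKernel ε L Λ ξ
  have hg_eq : g = lmarginalAverage (fun _ => spinVolume L) (boltzmann ε Λ) Λ f :=
    funext fun ξ => lintegral_gibbsKernel Λ ξ hf
  have hg : Measurable g := hg_eq ▸ measurable_lmarginalAverage (measurable_boltzmann Λ) hf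
  have hg₁ (ξ : Site d → Spin L) : g ξ ≤ 1 :=
    (lintegral_mono hf₁).trans_eq (by rw [lintegral_const, measure_univ, mul_one])
  have hΔ : (Δ : Set (Site d)) ⊆ Δ' := Finset.coe_subset.2 Finset.subset_union_left
  have hΛ : (thickening Λ 1 : Set (Site d)) ⊆ Δ' := Finset.coe_subset.2 Finset.subset_union_right
  have hgΔ : DependsOn g (Δ' : Set (Site d)) := hg_eq ▸ dependsOn_lmarginalAverage_of_dependsOn
    ((dependsOn_boltzmann ε Λ).mono hΛ) (hfΔ.mono hΔ)
  -- The finite-volume Gibbs measures in the growing boxes approximate the law of the coding.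
  let μ : ℕ → Measure (Site d → Spin L) := fun n => gibbsKernel ε L (thickening Δ' n) fun _ => s
  have hprob (n : ℕ) : IsProbabilityMeasure (μ n) := inferInstanceAs
    (IsProbabilityMeasure (gibbsKernel ε L (thickening Δ' n) fun _ => s))
  have hμ (n : ℕ) (i : Site d) (hi : i ∈ thickening Δ' n) : gibbsKernel ε L {i} ∘ₘ μ n = μ n :=
    gibbsKernel_comp_gibbsKernel_of_subset (Finset.singleton_subset_iff.2 hi) _
  have hΛn (n : ℕ) : Λ ⊆ thickening Δ' n := fun i hi => mem_thickening.2
    ⟨i, hΛ (mem_thickening.2 ⟨i, hi, by simp [latticeDist_self]⟩), by simp [latticeDist_self]⟩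
  have hfg (n : ℕ) : ∫⁻ ξ, g ξ ∂μ n = ∫⁻ x, f x ∂μ n :=
    lintegral_lintegral_gibbsKernel (gibbsKernel_comp_gibbsKernel_of_subset (hΛn n) _) hf
  rw [Measure.lintegral_bind (measurable_gibbsKernel Λ).aemeasurable hf.aemeasurable]
  refine tendsto_nhds_unique ?_ (tendsto_lintegral_pastLaw hr hμ hg hg₁ hgΔ s)
  simpa only [hfg] using tendsto_lintegral_pastLaw hr hμ hf hf₁ (hfΔ.mono hΔ) s

theorem IsTruncatedGibbs.eq_pastLaw (hr : survivalRate d L ε < 1) (s : Spin L)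
    {μ : Measure (Site d → Spin L)} (hμ : IsTruncatedGibbs ε L μ) : μ = pastLaw d L ε s := by
  have := hμ.isProbabilityMeasure
  have hinv := isTruncatedGibbs_iff_forall_gibbsKernel_comp_eq.1 hμ
  exact measure_ext_of_dependsOn fun Δ f hf hf₁ hfΔ => tendsto_nhds_unique tendsto_const_nhds
    (tendsto_lintegral_pastLaw hr (fun _ i _ => hinv {i}) hf hf₁ hfΔ s)

theorem measure_lt_codingRadius_pastCoding_le (ε : ℝ) (s : Spin L) (n : ℕ) :
    spaceTimeMeasure (Site d) (seedMeasure L) {y | n < codingRadius (pastCoding ε s) 0 y} ≤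
      survivalRate d L ε ^ n :=
  (measure_mono fun _ hy => not_not.1 fun hdead =>
    (codingRadius_pastCoding_le hdead).not_gt hy).trans (measure_alive_le ε n 0)

end PastLaw

section GeometricTail

variable {Ω : Type*} [MeasurableSpace Ω] {P : Measure Ω} {R : Ω → ℕ∞} {r : ℝ≥0∞}

theorem ae_ne_top_of_measure_lt_le_pow (hr : r < 1) (h : ∀ n : ℕ, P {ω | n < R ω} ≤ r ^ n) :
    ∀ᵐ ω ∂P, R ω ≠ ⊤ := by
  refine le_antisymm (ge_of_tendsto' (ENNReal.tendsto_pow_atTop_nhds_zero_of_lt_one hr)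
    fun n => ?_) zero_le
  refine (measure_mono fun ω hω => ?_).trans (h n)
  have htop : R ω = ⊤ := not_not.1 hω
  change (n : ℕ∞) < R ω
  exact htop ▸ ENat.natCast_lt_top n

theorem exists_measure_le_mul_exp [IsProbabilityMeasure P] (hr : r < 1)
    (h : ∀ n : ℕ, P {ω | n < R ω} ≤ r ^ n) :
    ∃ C : ℝ, 0 < C ∧ ∃ c : ℝ, 0 < c ∧ ∀ n : ℕ,
      P {ω | n ≤ R ω} ≤ ENNReal.ofReal (C * Real.exp (-c * n)) := by
  obtain ⟨c, hc, hrc⟩ : ∃ c : ℝ, 0 < c ∧ r ≤ ENNReal.ofReal (Real.exp (-c)) := by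
    obtain ⟨q, hrq, hq⟩ := ENNReal.lt_iff_exists_nnreal_btwn.1 hr
    have hq₀ : 0 < (q : ℝ) := ENNReal.coe_pos.1 (zero_le.trans_lt hrq)
    have hq₁ : (q : ℝ) < 1 := ENNReal.coe_lt_one_iff.1 hq
    refine ⟨-Real.log q, neg_pos.2 (Real.log_neg hq₀ hq₁), ?_⟩
    rw [neg_neg, Real.exp_log hq₀, ENNReal.ofReal_coe_nnreal]
    exact hrq.le
  refine ⟨Real.exp c, Real.exp_pos c, c, hc, fun n => ?_⟩
  rw [← Real.exp_add]
  cases n with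
  | zero =>
    refine prob_le_one.trans (ENNReal.one_le_ofReal.2 (Real.one_le_exp ?_))
    simpa using hc.le
  | succ n =>
    calc P {ω | (n + 1 : ℕ) ≤ R ω} ≤ P {ω | n < R ω} := measure_mono fun ω hω =>
          show (n : ℕ∞) < R ω from (Nat.cast_lt.2 n.lt_succ_self).trans_le hω
      _ ≤ r ^ n := h n
      _ ≤ ENNReal.ofReal (Real.exp (-c)) ^ n := by gcongr
      _ = ENNReal.ofReal (Real.exp (c + -c * (n + 1 : ℕ))) := by
          rw [← ENNReal.ofReal_pow (Real.exp_pos _).le, ← Real.exp_nat_mul]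
          congr 2
          push_cast
          ring

end GeometricTail

theorem isFFIIDWithExpTails_pastLaw {d : ℕ} {L ε : ℝ} [Fact (0 < L)]
    (hr : survivalRate d L ε < 1) (s : Spin L) : IsFFIIDWithExpTails (pastLaw d L ε s) :=
  ⟨ℕ → Seed L, inferInstance, Measure.infinitePi fun _ => seedMeasure L, inferInstance,
    pastCoding ε s, ⟨measurable_pastCoding, pastCoding_shiftConfig, rfl⟩,
    ae_ne_top_of_measure_lt_le_pow hr (measure_lt_codingRadius_pastCoding_le ε s),
    exists_measure_le_mul_exp hr (measure_lt_codingRadius_pastCoding_le ε s)⟩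

end

theorem theorem2 (d : ℕ) (hd : 1 ≤ d) (L : ℝ) (hL : 0 < L) :
    ∃ ε₀ : ℝ, 0 < ε₀ ∧ ∀ ε : ℝ, |ε| < ε₀ →
      (∃! μ : Measure (Site d → Set.Icc (-L) L), IsTruncatedGibbs ε L μ) ∧
      ∀ μ : Measure (Site d → Set.Icc (-L) L), IsTruncatedGibbs ε L μ →
        IsFFIIDWithExpTails μ ∧
        ∃ c : ℝ, 0 < c ∧ ∀ l : ℕ, ∃ ν : Measure (Site d → Set.Icc (-L) L),
          IsProbabilityMeasure ν ∧ IsDependentOfRange l ν ∧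
          ∀ Λ : Finset (Site d),
            tvDistance (marginal μ Λ) (marginal ν Λ) ≤ (Λ.card : ℝ) * Real.exp (-c * l) := by
  have : Fact (0 < L) := ⟨hL⟩
  refine ⟨(1 / 2) ^ (2 * d + 1) / ((2 * d + 1) * (2 * L ^ 2)), by positivity, fun ε hε => ?_⟩
  have hr : survivalRate d L ε < 1 := survivalRate_lt_one hL.ne' hε
  let s : Spin L := ⟨0, by constructor <;> linarith⟩
  refine ⟨⟨pastLaw d L ε s, isTruncatedGibbs_pastLaw hr s, fun μ hμ => hμ.eq_pastLaw hr s⟩,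
    fun μ hμ => ?_⟩
  have := hμ.isProbabilityMeasure
  have hFF : IsFFIIDWithExpTails μ := by
    rw [hμ.eq_pastLaw hr s]
    exact isFFIIDWithExpTails_pastLaw hr s
  exact ⟨hFF, hFF.exists_finitely_dependent_approx⟩
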